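/- Let $d_y\ge 1$ and let $f:\mathbb R^{d_x}\times\mathbb R^{d_y}\to\mathbb R$ be twice differentiable. All norms are Euclidean norms of vectors and spectral norms of matrices. Assume that there are constants $\ell,\rho,\mu>0$ such that, for all $x,x',y,y'$, $$\|\nabla f(x,y)-\nabla f(x',y')\|^2\le \ell^2(\|x-x'\|^2+\|y-y'\|^2),\qquad \|\nabla^2 f(x,y)-\nabla^2 f(x',y')\|^2\le \rho^2(\|x-x'\|^2+\|y-y'\|^2),$$ $$f(x,y)\le f(x,y')+\nabla_y f(x,y')^\top(y-y')-\tfrac{\mu}{2}\|y-y'\|^2,$$ and that $P(x)=\max_{y}f(x,y)$ is bounded below. Put $P^*=\inf_x P(x)$, $y^*(x)=\arg\max_y f(x,y)$, $\kappa=\ell/\mu$ and $M=4\sqrt2\,\kappa^3\rho$. A point $x$ is an $(\varepsilon,\delta)$-second-order stationary point of $P$ if $P$ is twice differentiable at $x$, $\|\nabla P(x)\|\le\varepsilon$ and $\nabla^2P(x)\succeq-\delta I$. For $h:\mathbb R^{d_y}\to\mathbb R$ let $\mathrm{AGD}(h,y_0,K)$ be the point $y_K$ obtained from $\tilde y_0=y_0$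 by $K$ steps $$y_{k+1}=\tilde y_k-\tfrac1\ell\nabla h(\tilde y_k),\qquad \tilde y_{k+1}=y_{k+1}+\tfrac{\sqrt\kappa-1}{\sqrt\kappa+1}(y_{k+1}-y_k)$$ ($K$ gradient calls). Let $x_0\in\mathbb R^{d_x}$ and $\varepsilon>0$, and put $\Delta=P(x_0)-P^*$, $r_0=\|y^*(x_0)\|$, $\varepsilon'=2^{-2.5}\varepsilon$, $\tilde\varepsilon'=\min\{\frac{\varepsilon'}{192\,\ell},\frac{\sqrt{M\varepsilon'}}{48\,\rho}\}$ and $T=\lceil192\,\Delta\sqrt M\,\varepsilon'^{-1.5}\rceil+1$. The minimax cubic Newton method (MCN) first computes $y_0=\mathrm{AGD}(-f(x_0,\cdot),0,K_0)$, and then, in the rounds $t=0,1,\dots,T-1$: 1. if $t\ge1$, computes $y_t=\mathrm{AGD}(-f(x_t,\cdot),y_{t-1},K_t)$; 2. forms $g_t=\nabla_xf(x_t,y_t)$ (one gradient call) and $H_t=\nabla^2_{xx}f-\nabla^2_{xy}f(\nabla^2_{yy}f)^{-1}\nabla^2_{yx}f$ at $(x_t,y_t)$ (one Hessian call and one inversion);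 3. computes a global minimiser $s_t$ of $s\mapsto g_t^\top s+\frac12s^\top H_ts+\frac M6\|s\|^3$ (one call of an exact cubic sub-problem solver); 4. stops if $\|s_t\|\le\frac12\sqrt{\varepsilon'/M}$, and otherwise sets $x_{t+1}=x_t+s_t$. The output is $\hat x=x_t+s_t$ for the last executed round $t$. The numbers of AGD steps are $$K_0=\Big\lceil2\sqrt\kappa\,\log\Big(\tfrac{\sqrt{\kappa+1}}{\tilde\varepsilon'}\,r_0\Big)\Big\rceil,\qquad K_t=\Big\lceil2\sqrt\kappa\,\log\Big(\tfrac{\sqrt{\kappa+1}}{\tilde\varepsilon'}\big(\tilde\varepsilon'+\kappa\|s_{t-1}\|\big)\Big)\Big\rceil\quad(t\ge1),$$ where $K_0$ is read as $0$ if $r_0=0$ or if the expression is negative. Then, whichever minimisers the exact solver returns, the output $\hat x$ is an $(\varepsilon,\kappa^{1.5}\sqrt{\rho\varepsilon})$-second-order stationary point of $P$. Moreover there is a universal constant $C>0$, independent of $d_x,d_y,f,\ell,\rho,\mu,x_0,\varepsilon$ and of the solver, such that the total number of gradient calls is at most $$C\big(\Delta\,\kappa^2\sqrt\rho\,\varepsilon^{-1.5}+\sqrt\kappa\big)\,\log\Big(2+\kappa+\frac{\ell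 r_0}{\varepsilon}+r_0\sqrt{\frac{\rho}{\varepsilon}}+\frac{\ell}{\sqrt{\rho\varepsilon}}\Big),$$ i.e. $\tilde O(\kappa^2\sqrt\rho\,\varepsilon^{-1.5})$, and the number of Hessian calls, the number of inversions of $\nabla^2_{yy}f$ and the number of exact cubic sub-problem calls are each at most $$C\big(\Delta\,\kappa^{1.5}\sqrt\rho\,\varepsilon^{-1.5}+1\big),$$ i.e. $O(\kappa^{1.5}\sqrt\rho\,\varepsilon^{-1.5})$. -/

import Mathlib

noncomputable section

namespace MCN

/-- `ℝⁿ` with the Euclidean norm. -/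
abbrev Vec (n : ℕ) : Type := EuclideanSpace ℝ (Fin n)

section Calculus

variable {dx dy : ℕ}

/-- `f` as a function of the pair `(x, y)`; `WithLp 2` puts the Euclidean norm
`√(‖x‖² + ‖y‖²)` on the product. -/
def joint (f : Vec dx → Vec dy → ℝ) : WithLp 2 (Vec dx × Vec dy) → ℝ :=
  fun z => f z.fst z.snd

/-- The full gradient `∇f(x, y)`. -/
def grad (f : Vec dx → Vec dy → ℝ) (x : Vec dx) (y : Vec dy) : WithLp 2 (Vec dx × Vec dy) :=
  gradient (joint f) (WithLp.toLp 2 (x, y))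

/-- The full Hessian `∇²f(x, y)`, as an operator; its norm is the spectral norm. -/
def hess (f : Vec dx → Vec dy → ℝ) (x : Vec dx) (y : Vec dy) :
    WithLp 2 (Vec dx × Vec dy) →L[ℝ] WithLp 2 (Vec dx × Vec dy) :=
  fderiv ℝ (gradient (joint f)) (WithLp.toLp 2 (x, y))

/-- The partial gradient `∇ₓf(x, y)`. -/
def gradX (f : Vec dx → Vec dy → ℝ) (x : Vec dx) (y : Vec dy) : Vec dx :=
  gradient (fun x' => f x' y) x

/-- The partial gradient `∇_y f(x, y)`. -/
def gradY (f : Vec dx → Vec dy → ℝ) (x : Vec dx) (y : Vec dy) : Vec dy :=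
  gradient (fun y' => f x y') y

/-- The block `∇²ₓₓf(x, y)`. -/
def hessXX (f : Vec dx → Vec dy → ℝ) (x : Vec dx) (y : Vec dy) : Vec dx →L[ℝ] Vec dx :=
  fderiv ℝ (fun x' => gradX f x' y) x

/-- The block `∇²_{xy}f(x, y)`, a `dx × dy` matrix. -/
def hessXY (f : Vec dx → Vec dy → ℝ) (x : Vec dx) (y : Vec dy) : Vec dy →L[ℝ] Vec dx :=
  fderiv ℝ (fun y' => gradX f x y') y

/-- The block `∇²_{yx}f(x, y)`, a `dy × dx` matrix. -/
def hessYX (f : Vec dx → Vec dy → ℝ) (x : Vec dx) (y : Vec dy) : Vec dx →L[ℝ] Vec dy :=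
  fderiv ℝ (fun x' => gradY f x' y) x

/-- The block `∇²_{yy}f(x, y)`. -/
def hessYY (f : Vec dx → Vec dy → ℝ) (x : Vec dx) (y : Vec dy) : Vec dy →L[ℝ] Vec dy :=
  fderiv ℝ (fun y' => gradY f x y') y

/-- `∇²ₓₓf - ∇²_{xy}f (∇²_{yy}f)⁻¹ ∇²_{yx}f` at `(x, y)`. -/
def schurHess (f : Vec dx → Vec dy → ℝ) (x : Vec dx) (y : Vec dy) : Vec dx →L[ℝ] Vec dx :=
  hessXX f x y - (hessXY f x y).comp ((hessYY f x y).inverse.comp (hessYX f x y))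

/-- The primal function `P(x) = max_y f(x, y)`. -/
def primal (f : Vec dx → Vec dy → ℝ) (x : Vec dx) : ℝ := ⨆ y, f x y

/-- `P* = inf_x P(x)`. -/
def primalInf (f : Vec dx → Vec dy → ℝ) : ℝ := ⨅ x, primal f x

/-- `y*(x) = argmax_y f(x, y)`. -/
def yStar (f : Vec dx → Vec dy → ℝ) (x : Vec dx) : Vec dy :=
  Classical.epsilon fun y => ∀ y', f x y' ≤ f x y

/-- The standing assumptions: `f` is twice differentiable with `ℓ`-Lipschitz gradient and
`ρ`-Lipschitz Hessian, `μ`-strongly concave in `y`, and `P` is bounded below. -/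
structure Assumptions (f : Vec dx → Vec dy → ℝ) (ℓ ρ μ : ℝ) : Prop where
  ell_pos : 0 < ℓ
  rho_pos : 0 < ρ
  mu_pos : 0 < μ
  differentiable : Differentiable ℝ (joint f)
  differentiable_gradient : Differentiable ℝ (gradient (joint f))
  grad_lipschitz : ∀ x x' y y',
    ‖grad f x y - grad f x' y'‖ ^ 2 ≤ ℓ ^ 2 * (‖x - x'‖ ^ 2 + ‖y - y'‖ ^ 2)
  hess_lipschitz : ∀ x x' y y',
    ‖hess f x y - hess f x' y'‖ ^ 2 ≤ ρ ^ 2 * (‖x - x'‖ ^ 2 + ‖y - y'‖ ^ 2)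
  strongly_concave : ∀ x y y',
    f x y ≤ f x y' + inner ℝ (gradY f x y') (y - y') - μ / 2 * ‖y - y'‖ ^ 2
  primal_bddBelow : BddBelow (Set.range (primal f))

end Calculus

/-- `x` is an `(ε, δ)`-second-order stationary point of `P`: `P` is twice differentiable at `x`,
`‖∇P(x)‖ ≤ ε` and `∇²P(x) ⪰ -δ I`. -/
def IsSecondOrderStationary {n : ℕ} (P : Vec n → ℝ) (ε δ : ℝ) (x : Vec n) : Prop :=
  (∀ᶠ z in nhds x, DifferentiableAt ℝ P z) ∧
  DifferentiableAt ℝ (gradient P) x ∧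
  ‖gradient P x‖ ≤ ε ∧
  ∀ v : Vec n, -δ * ‖v‖ ^ 2 ≤ inner ℝ v (fderiv ℝ (gradient P) x v)

section AGD

/-- State of accelerated gradient descent: the iterate, the extrapolated iterate, and the number
of gradient evaluations made so far. -/
structure AGDState (n : ℕ) where
  y : Vec n
  yt : Vec n
  calls : ℕ

/-- One step: `y_{k+1} = ỹ_k - η ∇h(ỹ_k)`, `ỹ_{k+1} = y_{k+1} + θ (y_{k+1} - y_k)`. -/
def agdStep {n : ℕ} (h : Vec n → ℝ) (η θ : ℝ) (st : AGDState n) : AGDState n :=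
  let y' := st.yt - η • gradient h st.yt
  { y := y', yt := y' + θ • (y' - st.y), calls := st.calls + 1 }

/-- `AGD(h, y₀, K, η, θ)`: `K` steps from `y₀`; the output is the field `y`. -/
def agd {n : ℕ} (h : Vec n → ℝ) (y₀ : Vec n) (K : ℕ) (η θ : ℝ) : AGDState n :=
  (agdStep h η θ)^[K] { y := y₀, yt := y₀, calls := 0 }

end AGD

section Algorithm

variable {dx dy : ℕ}

/-- The cubic model `gᵀs + ½ sᵀHs + (M/6)‖s‖³`. -/
def cubicModel (g : Vec dx) (H : Vec dx →L[ℝ] Vec dx) (M : ℝ) (s : Vec dx) : ℝ :=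
  inner ℝ g s + 1 / 2 * inner ℝ s (H s) + M / 6 * ‖s‖ ^ 3

/-- An exact cubic sub-problem solver: on every vector `g` and symmetric `H` it returns some
global minimiser of the cubic model. -/
def IsExactCubicSolver (M : ℝ) (solver : Vec dx → (Vec dx →L[ℝ] Vec dx) → Vec dx) : Prop :=
  ∀ g H, IsSelfAdjoint H → ∀ s, cubicModel g H M (solver g H) ≤ cubicModel g H M s

/-- The output point of a run together with the number of oracle calls it made: gradients of `f`,
Hessians of `f`, inversions of `∇²_{yy}f`, and exact solutions of cubic sub-problems. -/
structure Outcome (dx : ℕ) where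
  point : Vec dx
  gradCalls : ℕ
  hessCalls : ℕ
  invCalls : ℕ
  cubicCalls : ℕ

/-- The loop of the algorithm, entered with the current pair `(x_t, y_t)`, where the first
argument is the number of rounds that may still follow the current one. A round forms
`g_t = ∇ₓf(x_t, y_t)` (one gradient call) and `H_t` (one Hessian, one inverse), and solves one
cubic sub-problem. The loop ends if `‖s_t‖ ≤ thr` or no round is left. Otherwise
`x_{t+1} = x_t + s_t`, and `y_{t+1}` is obtained by `K ‖s_t‖` steps of AGD on
`-f(x_{t+1}, ·)` from `y_t`. -/
def mcnLoop (f : Vec dx → Vec dy → ℝ) (solver : Vec dx → (Vec dx →L[ℝ] Vec dx) → Vec dx)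
    (η θ thr : ℝ) (K : ℝ → ℕ) : ℕ → Vec dx → Vec dy → Outcome dx
  | 0, x, y =>
    let s := solver (gradX f x y) (schurHess f x y)
    { point := x + s, gradCalls := 1, hessCalls := 1, invCalls := 1, cubicCalls := 1 }
  | n + 1, x, y =>
    let s := solver (gradX f x y) (schurHess f x y)
    if ‖s‖ ≤ thr then
      { point := x + s, gradCalls := 1, hessCalls := 1, invCalls := 1, cubicCalls := 1 }
    else
      let a := agd (fun y' => -f (x + s) y') y (K ‖s‖) η θ
      let r := mcnLoop f solver η θ thr K n (x + s) a.y
      { point := r.point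
        gradCalls := 1 + a.calls + r.gradCalls
        hessCalls := 1 + r.hessCalls
        invCalls := 1 + r.invCalls
        cubicCalls := 1 + r.cubicCalls }

/-- The minimax cubic Newton algorithm with at most `T ≥ 1` rounds, started at `x₀`:
`y₀` is obtained by `K₀` steps of AGD on `-f(x₀, ·)` from `0`, with step size `1/ℓ` and momentum
`(√κ - 1)/(√κ + 1)`; then the loop is run with break threshold `½ √(ε/M)`. -/
def mcn (f : Vec dx → Vec dy → ℝ) (solver : Vec dx → (Vec dx →L[ℝ] Vec dx) → Vec dx)
    (ℓ κ M ε : ℝ) (T K₀ : ℕ) (K : ℝ → ℕ) (x₀ : Vec dx) : Outcome dx :=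
  let η := 1 / ℓ
  let θ := (√κ - 1) / (√κ + 1)
  let a := agd (fun y' => -f x₀ y') 0 K₀ η θ
  let r := mcnLoop f solver η θ (1 / 2 * √(ε / M)) K (T - 1) x₀ a.y
  { r with gradCalls := a.calls + r.gradCalls }

end Algorithm

section Parameters

/-- `M = 4√2 κ³ρ`. -/
def cubicM (κ ρ : ℝ) : ℝ := 4 * √2 * κ ^ 3 * ρ

/-- `ε' = 2^{-2.5} ε`. -/
def epsPrime (ε : ℝ) : ℝ := (2 : ℝ) ^ (-(5 / 2) : ℝ) * ε

/-- `min {C_g ε/ℓ, C_H √(Mε)/ρ}` with `C_g = 1/192` and `C_H = 1/48`. -/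
def epsTilde (ℓ ρ M ε : ℝ) : ℝ := min (1 / 192 * ε / ℓ) (1 / 48 * √(M * ε) / ρ)

/-- `K₀ = ⌈2√κ log((√(κ+1)/e) r)⌉`, `r = ‖y*(x₀)‖`; no step if this is not positive or `r = 0`
(where `Real.log 0 = 0`). -/
def firstSteps (κ e r : ℝ) : ℕ := ⌈2 * √κ * Real.log (√(κ + 1) / e * r)⌉₊

/-- `K_t = ⌈2√κ log((√(κ+1)/e) (e + κ r))⌉`, `r = ‖s_{t-1}‖`, for `t ≥ 1`. -/
def laterSteps (κ e r : ℝ) : ℕ := ⌈2 * √κ * Real.log (√(κ + 1) / e * (e + κ * r))⌉₊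

/-- `T = ⌈192 Δ √M ε^{-1.5}⌉ + 1`. -/
def maxRounds (Δ M ε : ℝ) : ℕ := ⌈192 * Δ * √M * ε ^ (-(3 / 2) : ℝ)⌉₊ + 1

end Parameters

end MCN

end

/-!
The minimax cubic Newton method is cubic regularisation applied to `P(x) = max_y f(x, y)` with an
inexact gradient and Hessian.

By strong concavity `y*` is `κ`-Lipschitz, and implicit differentiation of `∇_y f(x, y*(x)) = 0`
(`Assumptions.hasFDerivAt_yStar`) shows that `P` is twice differentiable, that
`∇P(x) = ∇ₓf(x, y*(x))`, and that `∇²P(x)` is the Schur complement `S` of `∇²f` at `(x, y*(x))`.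
The quadratic form of `S` is the partial maximum of the quadratic form of the full Hessian
(`Assumptions.inner_hess_le_inner_schurHess`), attained at some `w` with `‖w‖ ≤ κ ‖s‖`. Hence `S`
is `(1 + κ²) ρ`-Lipschitz in `(x, y)`, and `∇²P` is Lipschitz with constant `M / 2`.

Nesterov's Lyapunov function (`agdPotential_step_le`) shows that the prescribed numbers of
accelerated steps keep `‖y_t - y*(x_t)‖` below the tolerance `ε̃'`. The gradient error is then at
most `ε'/192`. The Lipschitz bound for the Hessian error is `2κ²ρ ε̃' ≤ κ²ρ ε'/(96 ℓ)`, which by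
itself may exceed `√(M ε')`. But all Schur complements lie between `-ℓ` and `(1 + κ) ℓ`, so the
error is also at most `3κℓ`, and the geometric mean of the two bounds is at most `√(M ε')/12`
(`Assumptions.norm_schurHess_sub_le_of_epsTilde`).

Put `q = √(ε'/M)`. The first- and second-order conditions for a global minimiser `s` of the cubic
model show that a step with `‖s‖ > q/2` decreases `P` by at least `M‖s‖³/16`
(`cubic_step_descent`), while `‖s‖ ≤ q/2` makes `x + s` second-order stationary
(`cubic_step_gradient`, `cubic_step_hessian`). As `P` is bounded below, there are at most
`192 Δ / (M q³)` long steps. The gradient calls that follow a long step are also charged to the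
decrease of `P` (`Assumptions.mcnLoop_spec`): their number is of the order `√κ (log X + ‖s‖/q)`,
where `X` is the argument of the logarithm in the complexity bound, and `‖s‖/q` is at most
`4 (‖s‖/q)³`. Hence the logarithm does not depend on `Δ`.
-/

namespace MCN

open Filter Topology

/-! ### Taylor bounds for Lipschitz gradients and Hessians -/

section Taylor

variable {E : Type*} [NormedAddCommGroup E] [InnerProductSpace ℝ E]

/-- The quadratic upper model of a function with `c`-Lipschitz gradient `G`. -/
theorem le_quadratic_of_lipschitz_gradient [CompleteSpace E] {h : E → ℝ} {G : E → E} {c : ℝ}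
    (hG : ∀ z, HasGradientAt h (G z) z) (hlip : ∀ z w, ‖G z - G w‖ ≤ c * ‖z - w‖) (x s : E) :
    h (x + s) ≤ h x + inner ℝ (G x) s + c / 2 * ‖s‖ ^ 2 := by
  have hline : ∀ t : ℝ, HasDerivAt (fun t : ℝ => x + t • s) s t := fun t => by
    simpa using ((hasDerivAt_id t).smul_const s).const_add x
  have hd : ∀ t : ℝ, HasDerivAt (fun t : ℝ => h (x + t • s)) (inner ℝ (G (x + t • s)) s) t :=
    fun t => by
      have := (hG (x + t • s)).hasFDerivAt.comp_hasDerivAt t (hline t)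
      exact this.congr_deriv (by simp)
  have hB : ∀ t : ℝ, HasDerivAt (fun t : ℝ => h x + t * inner ℝ (G x) s + c / 2 * t ^ 2 * ‖s‖ ^ 2)
      (inner ℝ (G x) s + c * t * ‖s‖ ^ 2) t := fun t => by
    have h1 := ((hasDerivAt_id t).mul_const (inner ℝ (G x) s)).const_add (h x)
    have h2 := (((hasDerivAt_id t).pow 2).const_mul (c / 2)).mul_const (‖s‖ ^ 2)
    refine (h1.add h2).congr_deriv ?_
    simp only [id]; ring
  have key := image_le_of_deriv_right_le_deriv_boundary (a := 0) (b := 1)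
    (f := fun t : ℝ => h (x + t • s)) (f' := fun t => inner ℝ (G (x + t • s)) s)
    (fun t _ => (hd t).continuousAt.continuousWithinAt)
    (fun t _ => (hd t).hasDerivWithinAt)
    (B := fun t : ℝ => h x + t * inner ℝ (G x) s + c / 2 * t ^ 2 * ‖s‖ ^ 2)
    (by simp) (fun t _ => (hB t).continuousAt.continuousWithinAt)
    (fun t _ => (hB t).hasDerivWithinAt) (fun t ht => by
      have h1 : inner ℝ (G (x + t • s)) s - inner ℝ (G x) s ≤ c * t * ‖s‖ ^ 2 := by
        rw [← inner_sub_left]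
        have h2 := hlip (x + t • s) x
        have h4 : ‖x + t • s - x‖ = t * ‖s‖ := by
          rw [add_sub_cancel_left, norm_smul, Real.norm_of_nonneg ht.1]
        rw [h4] at h2
        calc inner ℝ (G (x + t • s) - G x) s ≤ ‖G (x + t • s) - G x‖ * ‖s‖ :=
              real_inner_le_norm _ _
          _ ≤ (c * (t * ‖s‖)) * ‖s‖ := by gcongr
          _ = c * t * ‖s‖ ^ 2 := by ring
      linarith)
  have := key (x := 1) (by simp)
  simpa using this

/-- First-order expansion of a map whose derivative is `L`-Lipschitz. -/
theorem norm_sub_sub_le_of_lipschitz_fderiv {F : Type*} [NormedAddCommGroup F] [NormedSpace ℝ F]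
    {G : E → F} {H : E → E →L[ℝ] F} {L : ℝ}
    (hH : ∀ z, HasFDerivAt G (H z) z) (hlip : ∀ z w, ‖H z - H w‖ ≤ L * ‖z - w‖) (x s : E) :
    ‖G (x + s) - G x - H x s‖ ≤ L / 2 * ‖s‖ ^ 2 := by
  have hline : ∀ t : ℝ, HasDerivAt (fun t : ℝ => x + t • s) s t := fun t => by
    simpa using ((hasDerivAt_id t).smul_const s).const_add x
  have hd : ∀ t : ℝ, HasDerivAt (fun t : ℝ => G (x + t • s) - G x - t • H x s)
      (H (x + t • s) s - H x s) t := fun t => by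
    have h1 := (hH (x + t • s)).comp_hasDerivAt t (hline t)
    have h2 := (hasDerivAt_id t).smul_const (H x s)
    exact ((h1.sub_const (G x)).sub h2).congr_deriv (by simp)
  have hB : ∀ t : ℝ, HasDerivAt (fun t : ℝ => L / 2 * t ^ 2 * ‖s‖ ^ 2) (L * t * ‖s‖ ^ 2) t :=
    fun t => by
      refine ((((hasDerivAt_id t).pow 2).const_mul (L / 2)).mul_const (‖s‖ ^ 2)).congr_deriv ?_
      simp only [id]; ring
  have key := image_norm_le_of_norm_deriv_right_le_deriv_boundary (a := 0) (b := 1)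
    (f := fun t : ℝ => G (x + t • s) - G x - t • H x s)
    (fun t _ => (hd t).continuousAt.continuousWithinAt)
    (fun t _ => (hd t).hasDerivWithinAt)
    (B := fun t : ℝ => L / 2 * t ^ 2 * ‖s‖ ^ 2) (by simp) hB (fun t ht => by
      have h4 : ‖x + t • s - x‖ = t * ‖s‖ := by
        rw [add_sub_cancel_left, norm_smul, Real.norm_of_nonneg ht.1]
      calc ‖H (x + t • s) s - H x s‖ ≤ ‖H (x + t • s) - H x‖ * ‖s‖ := by
            simpa using (H (x + t • s) - H x).le_opNorm s
        _ ≤ (L * (t * ‖s‖)) * ‖s‖ := by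
            gcongr; rw [← h4]; exact hlip _ _
        _ = L * t * ‖s‖ ^ 2 := by ring)
  have := key (x := 1) (by simp)
  simpa using this

/-- The cubic upper model of a function with `L`-Lipschitz Hessian. -/
theorem le_cubic_of_lipschitz_hessian [CompleteSpace E] {h : E → ℝ} {G : E → E}
    {H : E → E →L[ℝ] E} {L : ℝ}
    (hG : ∀ z, HasGradientAt h (G z) z)
    (hH : ∀ z, HasFDerivAt G (H z) z) (hlip : ∀ z w, ‖H z - H w‖ ≤ L * ‖z - w‖) (x s : E) :
    h (x + s) ≤ h x + inner ℝ (G x) s + 1 / 2 * inner ℝ s (H x s) + L / 6 * ‖s‖ ^ 3 := by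
  have hline : ∀ t : ℝ, HasDerivAt (fun t : ℝ => x + t • s) s t := fun t => by
    simpa using ((hasDerivAt_id t).smul_const s).const_add x
  have hd : ∀ t : ℝ, HasDerivAt (fun t : ℝ => h (x + t • s)) (inner ℝ (G (x + t • s)) s) t :=
    fun t => by
      have := (hG (x + t • s)).hasFDerivAt.comp_hasDerivAt t (hline t)
      exact this.congr_deriv (by simp)
  have hB : ∀ t : ℝ, HasDerivAt (fun t : ℝ => h x + t * inner ℝ (G x) s
        + t ^ 2 * (1 / 2 * inner ℝ s (H x s)) + t ^ 3 * (L / 6 * ‖s‖ ^ 3))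
      (inner ℝ (G x) s + t * inner ℝ s (H x s) + L / 2 * t ^ 2 * ‖s‖ ^ 3) t := fun t => by
    have h1 := ((hasDerivAt_id t).mul_const (inner ℝ (G x) s)).const_add (h x)
    have h2 := ((hasDerivAt_id t).pow 2).mul_const (1 / 2 * inner ℝ s (H x s))
    have h3 := ((hasDerivAt_id t).pow 3).mul_const (L / 6 * ‖s‖ ^ 3)
    refine ((h1.add h2).add h3).congr_deriv ?_
    simp; ring
  have key := image_le_of_deriv_right_le_deriv_boundary (a := 0) (b := 1)
    (f := fun t : ℝ => h (x + t • s)) (f' := fun t => inner ℝ (G (x + t • s)) s)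
    (fun t _ => (hd t).continuousAt.continuousWithinAt)
    (fun t _ => (hd t).hasDerivWithinAt)
    (B := fun t : ℝ => h x + t * inner ℝ (G x) s
        + t ^ 2 * (1 / 2 * inner ℝ s (H x s)) + t ^ 3 * (L / 6 * ‖s‖ ^ 3))
    (by simp) (fun t _ => (hB t).continuousAt.continuousWithinAt)
    (fun t _ => (hB t).hasDerivWithinAt) (fun t ht => by
      have h2 := norm_sub_sub_le_of_lipschitz_fderiv hH hlip x (t • s)
      rw [norm_smul, Real.norm_of_nonneg ht.1, map_smul] at h2
      have h3 : inner ℝ (G (x + t • s) - G x - t • H x s) s ≤ L / 2 * t ^ 2 * ‖s‖ ^ 3 :=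
        calc inner ℝ (G (x + t • s) - G x - t • H x s) s
            ≤ ‖G (x + t • s) - G x - t • H x s‖ * ‖s‖ := real_inner_le_norm _ _
          _ ≤ (L / 2 * (t * ‖s‖) ^ 2) * ‖s‖ := by gcongr
          _ = L / 2 * t ^ 2 * ‖s‖ ^ 3 := by ring
      rw [inner_sub_left, inner_sub_left, inner_smul_left, real_inner_comm s (H x s)] at h3
      simp only [conj_trivial] at h3
      linarith)
  have := key (x := 1) (by simp)
  simpa using this

end Taylor

/-! ### Norms of self-adjoint operators -/

section SelfAdjoint

variable {E : Type*} [NormedAddCommGroup E] [InnerProductSpace ℝ E] [CompleteSpace E]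

/-- The norm of a self-adjoint operator is controlled by its quadratic form. -/
theorem norm_le_of_abs_inner_le {T : E →L[ℝ] E} (hT : IsSelfAdjoint T) {c : ℝ} (hc : 0 ≤ c)
    (h : ∀ v, |inner ℝ v (T v)| ≤ c * ‖v‖ ^ 2) : ‖T‖ ≤ c := by
  have hS : (T : E →ₗ[ℝ] E).IsSymmetric := hT.isSymmetric
  rw [T.norm_eq_iSup_rayleighQuotient hS]
  refine ciSup_le fun v => ?_
  rcases eq_or_ne v 0 with rfl | hv
  · simpa using hc
  · have : 0 < ‖v‖ ^ 2 := by positivity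
    rw [ContinuousLinearMap.rayleighQuotient, abs_div, abs_of_pos this, div_le_iff₀ this,
      ContinuousLinearMap.reApplyInnerSelf_apply, real_inner_comm]
    simpa using h v

end SelfAdjoint

/-! ### Global minimisers of the cubic model -/

section Cubic

variable {n : ℕ}

/-- Exact expansion of the cubic model around any point. -/
theorem cubicModel_sub {g : Vec n} {H : Vec n →L[ℝ] Vec n} (hH : IsSelfAdjoint H) (M : ℝ)
    (s d : Vec n) :
    cubicModel g H M (s + d) - cubicModel g H M s =
      inner ℝ (g + H s + (M / 2 * ‖s‖) • s) d
        + 1 / 2 * (inner ℝ d (H d) + M / 2 * ‖s‖ * ‖d‖ ^ 2)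
        + M / 6 * ((‖s + d‖ - ‖s‖) ^ 2 * (‖s + d‖ + ‖s‖ / 2)) := by
  have hsym : inner ℝ d (H s) = inner ℝ s (H d) := by
    rw [real_inner_comm]; exact hH.isSymmetric s d
  have hsq : ‖s + d‖ ^ 2 = ‖s‖ ^ 2 + 2 * inner ℝ s d + ‖d‖ ^ 2 := norm_add_sq_real s d
  have hcube : ‖s + d‖ ^ 3 = (‖s + d‖ - ‖s‖) ^ 2 * (‖s + d‖ + ‖s‖ / 2)
      + 3 / 2 * ‖s‖ * (2 * inner ℝ s d + ‖d‖ ^ 2) + ‖s‖ ^ 3 := by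
    have : 2 * inner ℝ s d + ‖d‖ ^ 2 = ‖s + d‖ ^ 2 - ‖s‖ ^ 2 := by rw [hsq]; ring
    rw [this]; ring
  have h3 : inner ℝ (H s) d = inner ℝ s (H d) := hH.isSymmetric s d
  unfold cubicModel
  rw [hcube]
  simp only [map_add, inner_add_left, inner_add_right, inner_smul_left, conj_trivial, hsym, h3]
  ring

theorem nonneg_of_forall_small {a b : ℝ} (h : ∀ t : ℝ, 0 < t → t ≤ 1 → 0 ≤ a + b * t) : 0 ≤ a := by
  by_contra! ha
  have hb : 0 < |b| + 1 := by positivity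
  set t := min 1 (-a / (2 * (|b| + 1))) with ht
  have htpos : 0 < t := lt_min one_pos (by apply div_pos <;> linarith)
  have h1 := h t htpos (min_le_left _ _)
  have h2 : t * (2 * (|b| + 1)) ≤ -a := by
    rw [← le_div_iff₀ (by linarith)]; exact min_le_right _ _
  have h3 : b * t ≤ |b| * t := by gcongr; exact le_abs_self b
  nlinarith

/-- First-order optimality condition for the cubic model. In the exact expansion all terms but the
linear one are of second order. -/
theorem cubicModel_first_order {g : Vec n} {H : Vec n →L[ℝ] Vec n} (hH : IsSelfAdjoint H) {M : ℝ}
    (hM : 0 < M) {s : Vec n} (hs : ∀ u, cubicModel g H M s ≤ cubicModel g H M u) :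
    g + H s + (M / 2 * ‖s‖) • s = 0 := by
  set r := g + H s + (M / 2 * ‖s‖) • s with hr
  have key : ∀ d : Vec n, 0 ≤ inner ℝ r d := by
    intro d
    apply nonneg_of_forall_small
      (b := 1 / 2 * (|inner ℝ d (H d)| + M / 2 * ‖s‖ * ‖d‖ ^ 2)
        + M / 6 * (‖d‖ ^ 2 * (‖d‖ + 2 * ‖s‖)))
    intro t ht ht1
    have h1 := cubicModel_sub (g := g) hH M s (t • d)
    have h2 := hs (s + t • d)
    have hn : ‖t • d‖ = t * ‖d‖ := by rw [norm_smul, Real.norm_of_nonneg ht.le]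
    -- The change of the norm is at most `t ‖d‖`, so the cubic remainder is of order `t²`.
    have h3 : (‖s + t • d‖ - ‖s‖) ^ 2 * (‖s + t • d‖ + ‖s‖ / 2)
        ≤ (t * ‖d‖) ^ 2 * (‖d‖ + 2 * ‖s‖) := by
      have h4 : |‖s + t • d‖ - ‖s‖| ≤ t * ‖d‖ := by
        have := abs_norm_sub_norm_le (s + t • d) s
        rwa [add_sub_cancel_left, hn] at this
      have h5 : (‖s + t • d‖ - ‖s‖) ^ 2 ≤ (t * ‖d‖) ^ 2 := by
        rw [← sq_abs]; gcongr
      have h6 : ‖s + t • d‖ ≤ ‖s‖ + ‖d‖ := by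
        refine (norm_add_le _ _).trans ?_
        rw [hn]; nlinarith [norm_nonneg d]
      exact mul_le_mul h5 (by linarith [norm_nonneg s]) (by positivity) (by positivity)
    rw [hn, inner_smul_right, map_smul, inner_smul_left, inner_smul_right] at h1
    simp only [conj_trivial] at h1
    have h7 : inner ℝ d (H d) ≤ |inner ℝ d (H d)| := le_abs_self _
    have h8 : 0 ≤ t * inner ℝ r d
        + 1 / 2 * (t * (t * |inner ℝ d (H d)|) + M / 2 * ‖s‖ * (t * ‖d‖) ^ 2)
        + M / 6 * ((t * ‖d‖) ^ 2 * (‖d‖ + 2 * ‖s‖)) := by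
      have h9 : t * (t * inner ℝ d (H d)) ≤ t * (t * |inner ℝ d (H d)|) := by gcongr
      have h10 := mul_le_mul_of_nonneg_left h3 (by positivity : 0 ≤ M / 6)
      linarith
    refine nonneg_of_mul_nonneg_right (a := t) ?_ ht
    refine h8.trans_eq (by ring)
  have h0 := key (-r)
  rw [inner_neg_right, real_inner_self_eq_norm_sq] at h0
  have : ‖r‖ ^ 2 = 0 := le_antisymm (by linarith) (by positivity)
  simpa using this

/-- Second-order optimality condition for a *global* minimiser of the cubic model. Off the
hyperplane orthogonal to `s`, reflect `s` to a point of equal norm; on it, the change of the norm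
is of second order. -/
theorem cubicModel_second_order {g : Vec n} {H : Vec n →L[ℝ] Vec n} (hH : IsSelfAdjoint H) {M : ℝ}
    (hM : 0 < M) {s : Vec n} (hs : ∀ u, cubicModel g H M s ≤ cubicModel g H M u) (v : Vec n) :
    0 ≤ inner ℝ v (H v) + M / 2 * ‖s‖ * ‖v‖ ^ 2 := by
  have h0 := cubicModel_first_order hH hM hs
  have hexp : ∀ t : ℝ, 0 ≤ t ^ 2 / 2 * (inner ℝ v (H v) + M / 2 * ‖s‖ * ‖v‖ ^ 2)
        + M / 6 * ((‖s + t • v‖ - ‖s‖) ^ 2 * (‖s + t • v‖ + ‖s‖ / 2)) := by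
    intro t
    have h1 := cubicModel_sub (g := g) hH M s (t • v)
    have h2 := hs (s + t • v)
    rw [h0, inner_zero_left, map_smul, inner_smul_left, inner_smul_right, norm_smul, mul_pow,
      Real.norm_eq_abs, sq_abs] at h1
    simp only [conj_trivial] at h1
    linarith
  by_cases hsv : inner ℝ s v = 0
  · apply nonneg_of_forall_small (b := M / 3 * ‖v‖ ^ 3)
    intro t ht ht1
    have h1 := hexp t
    have hn : ‖t • v‖ = t * ‖v‖ := by rw [norm_smul, Real.norm_of_nonneg ht.le]
    have hsq : ‖s + t • v‖ ^ 2 = ‖s‖ ^ 2 + t ^ 2 * ‖v‖ ^ 2 := by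
      rw [norm_add_sq_real, inner_smul_right, hsv, hn]; ring
    have hle : ‖s‖ ≤ ‖s + t • v‖ := by
      apply le_of_sq_le_sq _ (norm_nonneg _); rw [hsq]; nlinarith [sq_nonneg (t * ‖v‖)]
    have hd : ‖s + t • v‖ - ‖s‖ ≤ t * ‖v‖ := by
      have := norm_add_le s (t • v); rw [hn] at this; linarith
    have h2 : (‖s + t • v‖ - ‖s‖) ^ 2 * (‖s + t • v‖ + ‖s‖ / 2) ≤ t ^ 3 * ‖v‖ ^ 3 := by
      calc (‖s + t • v‖ - ‖s‖) ^ 2 * (‖s + t • v‖ + ‖s‖ / 2)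
          ≤ (‖s + t • v‖ - ‖s‖) ^ 2 * (‖s + t • v‖ + ‖s‖) := by
            gcongr; linarith [norm_nonneg s]
        _ = (‖s + t • v‖ - ‖s‖) * (‖s + t • v‖ ^ 2 - ‖s‖ ^ 2) := by ring
        _ = (‖s + t • v‖ - ‖s‖) * (t ^ 2 * ‖v‖ ^ 2) := by rw [hsq]; ring
        _ ≤ (t * ‖v‖) * (t ^ 2 * ‖v‖ ^ 2) := by gcongr
        _ = t ^ 3 * ‖v‖ ^ 3 := by ring
    have h3 := mul_le_mul_of_nonneg_left h2 (by positivity : 0 ≤ M / 6)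
    refine nonneg_of_mul_nonneg_right (a := t ^ 2 / 2) ?_ (by positivity)
    nlinarith
  · have hv : v ≠ 0 := by rintro rfl; simp at hsv
    have hv2 : ‖v‖ ^ 2 ≠ 0 := by positivity
    set t : ℝ := -(2 * inner ℝ s v / ‖v‖ ^ 2) with ht
    have ht0 : t ≠ 0 := by
      rw [ht, neg_ne_zero]; exact div_ne_zero (mul_ne_zero two_ne_zero hsv) hv2
    have hnorm : ‖s + t • v‖ = ‖s‖ := by
      rw [← sq_eq_sq₀ (norm_nonneg _) (norm_nonneg _), norm_add_sq_real, inner_smul_right,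
        norm_smul, mul_pow, Real.norm_eq_abs, sq_abs, ht]
      field_simp; ring
    have h1 := hexp t
    rw [hnorm, sub_self] at h1
    refine nonneg_of_mul_nonneg_right (a := t ^ 2 / 2) ?_ (by positivity)
    linarith

end Cubic

/-! ### Convergence of accelerated gradient descent -/

section AGD

variable {n : ℕ}

theorem agd_succ (h : Vec n → ℝ) (y₀ : Vec n) (K : ℕ) (η θ : ℝ) :
    agd h y₀ (K + 1) η θ = agdStep h η θ (agd h y₀ K η θ) := by
  simp [agd, Function.iterate_succ_apply']

theorem agd_calls (h : Vec n → ℝ) (y₀ : Vec n) (K : ℕ) (η θ : ℝ) :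
    (agd h y₀ K η θ).calls = K := by
  induction K with
  | zero => simp [agd]
  | succ K ih => rw [agd_succ, agdStep, ih]

/-- Nesterov's Lyapunov function: the gap of the iterate plus `μ/2` times the squared distance from
the minimiser `p` to the auxiliary point `ỹ + κ^{1/2} (ỹ - y)`; here `m = κ^{1/2}`. -/
noncomputable def agdPotential (h : Vec n → ℝ) (μ m : ℝ) (p : Vec n) (st : AGDState n) : ℝ :=
  h st.y - h p + μ / 2 * ‖st.yt + m • (st.yt - st.y) - p‖ ^ 2

variable {h : Vec n → ℝ} {ℓ μ m : ℝ}

/-- One accelerated step multiplies the Lyapunov function by at most `1 - 1/κ^{1/2}`. -/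
theorem agdPotential_step_le (hμ : 0 < μ) (hm : 1 ≤ m) (hℓ : ℓ = μ * m ^ 2)
    (hgrad : ∀ z, HasGradientAt h (gradient h z) z)
    (hlip : ∀ z w, ‖gradient h z - gradient h w‖ ≤ ℓ * ‖z - w‖)
    (hconv : ∀ z w, h w + inner ℝ (gradient h w) (z - w) + μ / 2 * ‖z - w‖ ^ 2 ≤ h z)
    (p : Vec n) (st : AGDState n) :
    agdPotential h μ m p (agdStep h (1 / ℓ) ((m - 1) / (m + 1)) st)
      ≤ (1 - 1 / m) * agdPotential h μ m p st := by
  obtain ⟨y, w, c⟩ := st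
  have hm0 : 0 < m := by linarith
  have hℓ0 : 0 < ℓ := by rw [hℓ]; positivity
  -- `p` is the comparison point, `A` and `B` are the displacements of the extrapolated point `w`
  -- from it and from the iterate `y`.
  set g := gradient h w with hg
  set A := w - p with hA
  set B := w - y with hB
  have e1 : (agdStep h (1 / ℓ) ((m - 1) / (m + 1)) ⟨y, w, c⟩).yt
      + m • ((agdStep h (1 / ℓ) ((m - 1) / (m + 1)) ⟨y, w, c⟩).yt
        - (agdStep h (1 / ℓ) ((m - 1) / (m + 1)) ⟨y, w, c⟩).y) - p
      = A + (m - 1) • B - (m / ℓ) • g := by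
    simp only [agdStep, ← hg, hA, hB]
    match_scalars <;> field_simp <;> ring
  have e2 : w + m • (w - y) - p = A + m • B := by
    rw [hA, hB]; module
  have hdesc : h (w - (1 / ℓ) • g) ≤ h w - 1 / (2 * ℓ) * ‖g‖ ^ 2 := by
    have := le_quadratic_of_lipschitz_gradient hgrad hlip w (-((1 / ℓ) • g))
    rw [← sub_eq_add_neg, norm_neg, norm_smul, inner_neg_right, inner_smul_right, ← hg,
      real_inner_self_eq_norm_sq, mul_pow, Real.norm_eq_abs, sq_abs] at this
    refine this.trans_eq ?_
    field_simp; ring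
  have hp := hconv p w
  have hy := hconv y w
  have hpA : p - w = -A := by rw [hA]; abel
  have hyB : y - w = -B := by rw [hB]; abel
  rw [hpA, norm_neg, inner_neg_right, ← hg] at hp
  rw [hyB, norm_neg, inner_neg_right, ← hg] at hy
  have hy' : h w - inner ℝ g B ≤ h y := by nlinarith [sq_nonneg ‖B‖]
  have n1 : ‖A + (m - 1) • B - (m / ℓ) • g‖ ^ 2 = ‖A‖ ^ 2 + (m - 1) ^ 2 * ‖B‖ ^ 2
      + (m / ℓ) ^ 2 * ‖g‖ ^ 2 + 2 * (m - 1) * inner ℝ A B - 2 * (m / ℓ) * inner ℝ g A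
      - 2 * (m - 1) * (m / ℓ) * inner ℝ g B := by
    rw [norm_sub_sq_real, norm_add_sq_real]
    simp only [norm_smul, mul_pow, Real.norm_eq_abs, sq_abs, inner_smul_right, inner_add_left,
      inner_smul_left, conj_trivial, real_inner_comm g A, real_inner_comm g B]
    ring
  have n2 : ‖A + m • B‖ ^ 2 = ‖A‖ ^ 2 + m ^ 2 * ‖B‖ ^ 2 + 2 * m * inner ℝ A B := by
    rw [norm_add_sq_real]
    simp only [norm_smul, mul_pow, Real.norm_eq_abs, sq_abs, inner_smul_right]
    ring
  unfold agdPotential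
  rw [e1]
  simp only [agdStep, ← hg]
  rw [e2, n1, n2]
  have hml : m / ℓ = 1 / (μ * m) := by rw [hℓ]; field_simp
  -- The descent bound, with `h w - h p` split in the proportions `1/m` and `1 - 1/m` between strong
  -- convexity towards `p` and convexity towards `y`.
  have key : h (w - (1 / ℓ) • g) - h p ≤ (1 - 1 / m) * (h y + inner ℝ g B - h p)
      + 1 / m * (inner ℝ g A - μ / 2 * ‖A‖ ^ 2) - 1 / (2 * ℓ) * ‖g‖ ^ 2 := by
    have i1 : 0 ≤ 1 / m := by positivity
    have i2 : 0 ≤ 1 - 1 / m := by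
      rw [sub_nonneg, div_le_one hm0]; exact hm
    have j1 := mul_le_mul_of_nonneg_left
      (show h w - h p ≤ inner ℝ g A - μ / 2 * ‖A‖ ^ 2 by linarith) i1
    have j2 := mul_le_mul_of_nonneg_left (show h w - h p ≤ h y + inner ℝ g B - h p by linarith) i2
    linarith
  have hB0 : 0 ≤ μ / 2 * (m - 1) * ‖B‖ ^ 2 := by
    have : 0 ≤ m - 1 := by linarith
    positivity
  -- The inner products with `g` cancel, and the slack is the convexity defect of the square norm.
  have hid : (1 - 1 / m) * (h y - h p + μ / 2 * (‖A‖ ^ 2 + m ^ 2 * ‖B‖ ^ 2 + 2 * m * inner ℝ A B))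
      - ((1 - 1 / m) * (h y + inner ℝ g B - h p)
        + 1 / m * (inner ℝ g A - μ / 2 * ‖A‖ ^ 2) - 1 / (2 * ℓ) * ‖g‖ ^ 2
        + μ / 2 * (‖A‖ ^ 2 + (m - 1) ^ 2 * ‖B‖ ^ 2
      + (m / ℓ) ^ 2 * ‖g‖ ^ 2 + 2 * (m - 1) * inner ℝ A B - 2 * (m / ℓ) * inner ℝ g A
      - 2 * (m - 1) * (m / ℓ) * inner ℝ g B)) = μ / 2 * (m - 1) * ‖B‖ ^ 2 := by
    rw [hml, hℓ]; field_simp; ring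
  linarith

/-- Linear convergence of accelerated gradient descent, in terms of the distance to the minimiser
`p`; here `m = κ^{1/2}`. -/
theorem norm_agd_sub_le (hμ : 0 < μ) (hm : 1 ≤ m) (hℓ : ℓ = μ * m ^ 2)
    (hgrad : ∀ z, HasGradientAt h (gradient h z) z)
    (hlip : ∀ z w, ‖gradient h z - gradient h w‖ ≤ ℓ * ‖z - w‖)
    (hconv : ∀ z w, h w + inner ℝ (gradient h w) (z - w) + μ / 2 * ‖z - w‖ ^ 2 ≤ h z)
    {p : Vec n} (hp : gradient h p = 0) (y₀ : Vec n) (K : ℕ) :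
    ‖(agd h y₀ K (1 / ℓ) ((m - 1) / (m + 1))).y - p‖
      ≤ √(m ^ 2 + 1) * Real.exp (-(K / (2 * m))) * ‖y₀ - p‖ := by
  have hm0 : 0 < m := by linarith
  have hpot : ∀ K : ℕ, agdPotential h μ m p (agd h y₀ K (1 / ℓ) ((m - 1) / (m + 1)))
      ≤ Real.exp (-(K / m)) * (μ / 2 * ((m ^ 2 + 1) * ‖y₀ - p‖ ^ 2)) := by
    intro K
    induction K with
    | zero =>
      have := le_quadratic_of_lipschitz_gradient hgrad hlip p (y₀ - p)
      rw [hp, add_sub_cancel, inner_zero_left] at this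
      simp only [agd, agdPotential, Function.iterate_zero, id, sub_self, smul_zero, add_zero,
        Nat.cast_zero, zero_div, neg_zero, Real.exp_zero, one_mul]
      rw [hℓ] at this
      linarith
    | succ K ih =>
      rw [agd_succ]
      refine (agdPotential_step_le hμ hm hℓ hgrad hlip hconv p _).trans ?_
      have h1 : 0 ≤ 1 - 1 / m := by rw [sub_nonneg, div_le_one hm0]; exact hm
      have h2 : 1 - 1 / m ≤ Real.exp (-(1 / m)) := by
        have := Real.add_one_le_exp (-(1 / m)); linarith
      have h3 : Real.exp (-((K + 1 : ℕ) / m)) = Real.exp (-(1 / m)) * Real.exp (-(K / m)) := by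
        rw [← Real.exp_add]; congr 1; push_cast; ring
      rw [h3, mul_assoc]
      exact mul_le_mul h2 ih (by
        unfold agdPotential
        have := hconv (agd h y₀ K (1 / ℓ) ((m - 1) / (m + 1))).y p
        rw [hp, inner_zero_left] at this
        have h4 : 0 ≤ μ / 2 * ‖(agd h y₀ K (1 / ℓ) ((m - 1) / (m + 1))).y - p‖ ^ 2 := by positivity
        have h5 : 0 ≤ h (agd h y₀ K (1 / ℓ) ((m - 1) / (m + 1))).y - h p := by linarith
        positivity) (Real.exp_pos _).le
  have hK := hpot K
  unfold agdPotential at hK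
  have h1 := hconv (agd h y₀ K (1 / ℓ) ((m - 1) / (m + 1))).y p
  rw [hp, inner_zero_left] at h1
  set Y := agd h y₀ K (1 / ℓ) ((m - 1) / (m + 1))
  have h2 : 0 ≤ μ / 2 * ‖Y.yt + m • (Y.yt - Y.y) - p‖ ^ 2 := by positivity
  have h3 : μ / 2 * ‖Y.y - p‖ ^ 2
      ≤ μ / 2 * (Real.exp (-(K / m)) * ((m ^ 2 + 1) * ‖y₀ - p‖ ^ 2)) := by linarith
  have h4 := le_of_mul_le_mul_left h3 (by positivity)
  refine le_of_sq_le_sq ?_ (by positivity)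
  refine h4.trans_eq ?_
  have h5 : Real.exp (-(K / m)) = Real.exp (-(K / (2 * m))) ^ 2 := by
    rw [← Real.exp_nat_mul]; congr 1; push_cast; field_simp
  rw [h5, mul_pow, mul_pow, Real.sq_sqrt (by positivity)]
  ring

/-- The prescribed number of accelerated steps brings the iterate within `e` of the minimiser. -/
theorem norm_agd_sub_le_of_steps {κ e r : ℝ} (hμ : 0 < μ) (hκ : 1 ≤ κ) (hℓ : ℓ = μ * κ) (he : 0 < e)
    (hgrad : ∀ z, HasGradientAt h (gradient h z) z)
    (hlip : ∀ z w, ‖gradient h z - gradient h w‖ ≤ ℓ * ‖z - w‖)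
    (hconv : ∀ z w, h w + inner ℝ (gradient h w) (z - w) + μ / 2 * ‖z - w‖ ^ 2 ≤ h z)
    {p : Vec n} (hp : gradient h p = 0) {y₀ : Vec n} (hr : ‖y₀ - p‖ ≤ r) {K : ℕ}
    (hK : 2 * √κ * Real.log (√(κ + 1) / e * r) ≤ K) :
    ‖(agd h y₀ K (1 / ℓ) ((√κ - 1) / (√κ + 1))).y - p‖ ≤ e := by
  have hm : 1 ≤ √κ := Real.one_le_sqrt.2 hκ
  have hs : √κ ^ 2 = κ := Real.sq_sqrt (by linarith)
  have h1 := norm_agd_sub_le hμ hm (by rw [hs]; exact hℓ) hgrad hlip hconv hp y₀ K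
  rw [hs] at h1
  refine h1.trans ?_
  have hr0 : 0 ≤ r := (norm_nonneg _).trans hr
  refine (mul_le_mul_of_nonneg_left hr (by positivity)).trans ?_
  rcases hr0.eq_or_lt with rfl | hr1
  · simpa using he.le
  have hpos : 0 < √(κ + 1) / e * r := by
    have : 0 < √(κ + 1) := Real.sqrt_pos.2 (by linarith)
    positivity
  have h2 : Real.log (√(κ + 1) / e * r) ≤ K / (2 * √κ) := by
    rw [le_div_iff₀ (by positivity)]; linarith
  have h3 : √(κ + 1) / e * r ≤ Real.exp (K / (2 * √κ)) := by
    rwa [← Real.log_le_iff_le_exp hpos]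
  rw [Real.exp_neg]
  have h4 : √(κ + 1) * r ≤ e * Real.exp (K / (2 * √κ)) := by
    calc √(κ + 1) * r = e * (√(κ + 1) / e * r) := by field_simp
      _ ≤ _ := by gcongr
  calc √(κ + 1) * (Real.exp (K / (2 * √κ)))⁻¹ * r
      = (√(κ + 1) * r) / Real.exp (K / (2 * √κ)) := by ring
    _ ≤ e := by rw [div_le_iff₀ (Real.exp_pos _)]; exact h4

end AGD

/-! ### Partial gradients and Hessian blocks -/

section Blocks

variable {dx dy : ℕ} {f : Vec dx → Vec dy → ℝ} {ℓ ρ μ : ℝ}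

/-- The isometric inclusion `x ↦ (x, 0)`. -/
noncomputable def inlL (dx dy : ℕ) : Vec dx →L[ℝ] WithLp 2 (Vec dx × Vec dy) :=
  ((WithLp.prodContinuousLinearEquiv 2 ℝ (Vec dx) (Vec dy)).symm :
    Vec dx × Vec dy →L[ℝ] WithLp 2 (Vec dx × Vec dy)).comp (ContinuousLinearMap.inl ℝ _ _)

/-- The isometric inclusion `y ↦ (0, y)`. -/
noncomputable def inrL (dx dy : ℕ) : Vec dy →L[ℝ] WithLp 2 (Vec dx × Vec dy) :=
  ((WithLp.prodContinuousLinearEquiv 2 ℝ (Vec dx) (Vec dy)).symm :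
    Vec dx × Vec dy →L[ℝ] WithLp 2 (Vec dx × Vec dy)).comp (ContinuousLinearMap.inr ℝ _ _)

theorem inlL_apply (v : Vec dx) : inlL dx dy v = WithLp.toLp 2 (v, 0) := rfl

theorem inrL_apply (w : Vec dy) : inrL dx dy w = WithLp.toLp 2 (0, w) := rfl

theorem inlL_add_inrL (v : Vec dx) (w : Vec dy) :
    inlL dx dy v + inrL dx dy w = WithLp.toLp 2 (v, w) := by
  rw [inlL_apply, inrL_apply, ← WithLp.toLp_add]; simp

theorem inner_inlL (z : WithLp 2 (Vec dx × Vec dy)) (v : Vec dx) :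
    inner ℝ z (inlL dx dy v) = inner ℝ z.fst v := by
  simp [WithLp.prod_inner_apply, inlL_apply]

theorem inner_inrL (z : WithLp 2 (Vec dx × Vec dy)) (w : Vec dy) :
    inner ℝ z (inrL dx dy w) = inner ℝ z.snd w := by
  simp [WithLp.prod_inner_apply, inrL_apply]

theorem norm_inlL (v : Vec dx) : ‖inlL dx dy v‖ = ‖v‖ := by
  rw [← sq_eq_sq₀ (norm_nonneg _) (norm_nonneg _), WithLp.prod_norm_sq_eq_of_L2]
  simp [inlL_apply]

theorem norm_inrL (w : Vec dy) : ‖inrL dx dy w‖ = ‖w‖ := by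
  rw [← sq_eq_sq₀ (norm_nonneg _) (norm_nonneg _), WithLp.prod_norm_sq_eq_of_L2]
  simp [inrL_apply]

theorem hasFDerivAt_toLp {E : Type*} [NormedAddCommGroup E] [NormedSpace ℝ E]
    {u : E → Vec dx} {w : E → Vec dy} {u' : E →L[ℝ] Vec dx} {w' : E →L[ℝ] Vec dy} {x : E}
    (hu : HasFDerivAt u u' x) (hw : HasFDerivAt w w' x) :
    HasFDerivAt (fun x => (WithLp.toLp 2 (u x, w x) : WithLp 2 (Vec dx × Vec dy)))
      ((inlL dx dy).comp u' + (inrL dx dy).comp w') x := by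
  have h1 := ((inlL dx dy).hasFDerivAt.comp x hu).add ((inrL dx dy).hasFDerivAt.comp x hw)
  have h2 : (fun x => (WithLp.toLp 2 (u x, w x) : WithLp 2 (Vec dx × Vec dy)))
      = (inlL dx dy ∘ u) + (inrL dx dy ∘ w) := by
    funext x; exact (inlL_add_inrL _ _).symm
  rw [h2]; exact h1

theorem hasFDerivAt_toLp_left (x : Vec dx) (y : Vec dy) :
    HasFDerivAt (fun x' => (WithLp.toLp 2 (x', y) : WithLp 2 (Vec dx × Vec dy))) (inlL dx dy) x :=
  (hasFDerivAt_toLp (hasFDerivAt_id x) (hasFDerivAt_const y x)).congr_fderiv (by ext; simp)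

theorem hasFDerivAt_toLp_right (x : Vec dx) (y : Vec dy) :
    HasFDerivAt (fun y' => (WithLp.toLp 2 (x, y') : WithLp 2 (Vec dx × Vec dy))) (inrL dx dy) y :=
  (hasFDerivAt_toLp (hasFDerivAt_const x y) (hasFDerivAt_id y)).congr_fderiv (by ext; simp)

namespace Assumptions

variable (hf : Assumptions f ℓ ρ μ)
include hf

theorem hasGradientAt_joint (z : WithLp 2 (Vec dx × Vec dy)) :
    HasGradientAt (joint f) (gradient (joint f) z) z :=
  (hf.differentiable z).hasGradientAt

theorem hasFDerivAt_gradient_joint (x : Vec dx) (y : Vec dy) :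
    HasFDerivAt (gradient (joint f)) (hess f x y) (WithLp.toLp 2 (x, y)) :=
  (hf.differentiable_gradient _).hasFDerivAt

theorem hasGradientAt_left (x : Vec dx) (y : Vec dy) :
    HasGradientAt (fun x' => f x' y) (grad f x y).fst x := by
  rw [hasGradientAt_iff_hasFDerivAt]
  refine ((hf.hasGradientAt_joint _).hasFDerivAt.comp x (hasFDerivAt_toLp_left x y)).congr_fderiv ?_
  ext1 v
  exact inner_inlL _ v

theorem hasGradientAt_right (x : Vec dx) (y : Vec dy) :
    HasGradientAt (fun y' => f x y') (grad f x y).snd y := by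
  rw [hasGradientAt_iff_hasFDerivAt]
  refine ((hf.hasGradientAt_joint _).hasFDerivAt.comp y
    (hasFDerivAt_toLp_right x y)).congr_fderiv ?_
  ext1 v
  exact inner_inrL _ v

theorem gradX_eq (x : Vec dx) (y : Vec dy) : gradX f x y = (grad f x y).fst :=
  (hf.hasGradientAt_left x y).gradient

theorem gradY_eq (x : Vec dx) (y : Vec dy) : gradY f x y = (grad f x y).snd :=
  (hf.hasGradientAt_right x y).gradient

theorem hessXX_apply (x : Vec dx) (y : Vec dy) (v : Vec dx) :
    hessXX f x y v = (hess f x y (inlL dx dy v)).fst := by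
  have h1 := (WithLp.fstL 2 ℝ (Vec dx) (Vec dy)).hasFDerivAt.comp x
    ((hf.hasFDerivAt_gradient_joint x y).comp x (hasFDerivAt_toLp_left x y))
  have h2 : (fun x' => gradX f x' y) = (WithLp.fstL 2 ℝ (Vec dx) (Vec dy)) ∘
      (gradient (joint f) ∘ fun x' => (WithLp.toLp 2 (x', y))) := by
    funext x'; exact hf.gradX_eq x' y
  rw [hessXX, h2, h1.fderiv]; rfl

theorem hessXY_apply (x : Vec dx) (y : Vec dy) (w : Vec dy) :
    hessXY f x y w = (hess f x y (inrL dx dy w)).fst := by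
  have h1 := (WithLp.fstL 2 ℝ (Vec dx) (Vec dy)).hasFDerivAt.comp y
    ((hf.hasFDerivAt_gradient_joint x y).comp y (hasFDerivAt_toLp_right x y))
  have h2 : (fun y' => gradX f x y') = (WithLp.fstL 2 ℝ (Vec dx) (Vec dy)) ∘
      (gradient (joint f) ∘ fun y' => (WithLp.toLp 2 (x, y'))) := by
    funext y'; exact hf.gradX_eq x y'
  rw [hessXY, h2, h1.fderiv]; rfl

theorem hessYX_apply (x : Vec dx) (y : Vec dy) (v : Vec dx) :
    hessYX f x y v = (hess f x y (inlL dx dy v)).snd := by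
  have h1 := (WithLp.sndL 2 ℝ (Vec dx) (Vec dy)).hasFDerivAt.comp x
    ((hf.hasFDerivAt_gradient_joint x y).comp x (hasFDerivAt_toLp_left x y))
  have h2 : (fun x' => gradY f x' y) = (WithLp.sndL 2 ℝ (Vec dx) (Vec dy)) ∘
      (gradient (joint f) ∘ fun x' => (WithLp.toLp 2 (x', y))) := by
    funext x'; exact hf.gradY_eq x' y
  rw [hessYX, h2, h1.fderiv]; rfl

theorem hasFDerivAt_gradY (x : Vec dx) (y : Vec dy) :
    HasFDerivAt (fun y' => gradY f x y') (hessYY f x y) y := by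
  have h1 := (WithLp.sndL 2 ℝ (Vec dx) (Vec dy)).hasFDerivAt.comp y
    ((hf.hasFDerivAt_gradient_joint x y).comp y (hasFDerivAt_toLp_right x y))
  have h2 : (fun y' => gradY f x y') = (WithLp.sndL 2 ℝ (Vec dx) (Vec dy)) ∘
      (gradient (joint f) ∘ fun y' => (WithLp.toLp 2 (x, y'))) := by
    funext y'; exact hf.gradY_eq x y'
  rw [hessYY, h2, h1.fderiv]; exact h1

theorem hessYY_apply (x : Vec dx) (y : Vec dy) (w : Vec dy) :
    hessYY f x y w = (hess f x y (inrL dx dy w)).snd := by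
  have h1 := (WithLp.sndL 2 ℝ (Vec dx) (Vec dy)).hasFDerivAt.comp y
    ((hf.hasFDerivAt_gradient_joint x y).comp y (hasFDerivAt_toLp_right x y))
  have h2 : (fun y' => gradY f x y') = (WithLp.sndL 2 ℝ (Vec dx) (Vec dy)) ∘
      (gradient (joint f) ∘ fun y' => (WithLp.toLp 2 (x, y'))) := by
    funext y'; exact hf.gradY_eq x y'
  rw [hessYY, h2, h1.fderiv]; rfl

theorem inner_hess_comm (x : Vec dx) (y : Vec dy) (u v : WithLp 2 (Vec dx × Vec dy)) :
    inner ℝ (hess f x y u) v = inner ℝ u (hess f x y v) := by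
  have h1 : ∀ z, HasFDerivAt (joint f)
      (((InnerProductSpace.toDual ℝ (WithLp 2 (Vec dx × Vec dy))) ∘ gradient (joint f)) z) z :=
    fun z => (hf.hasGradientAt_joint z).hasFDerivAt
  have h2 : HasFDerivAt
      ((InnerProductSpace.toDual ℝ (WithLp 2 (Vec dx × Vec dy))) ∘ gradient (joint f))
      ((innerSL ℝ).comp (hess f x y)) (WithLp.toLp 2 (x, y)) :=
    (innerSL ℝ (E := WithLp 2 (Vec dx × Vec dy))).hasFDerivAt.comp _
      (hf.hasFDerivAt_gradient_joint x y)
  have h3 := second_derivative_symmetric h1 h2 u v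
  simp only [ContinuousLinearMap.comp_apply, innerSL_apply_apply] at h3
  rw [h3, real_inner_comm]

theorem norm_grad_sub_le (x x' : Vec dx) (y y' : Vec dy) :
    ‖grad f x y - grad f x' y'‖ ≤ ℓ * √(‖x - x'‖ ^ 2 + ‖y - y'‖ ^ 2) := by
  have := hf.ell_pos
  refine le_of_sq_le_sq ?_ (by positivity)
  rw [mul_pow, Real.sq_sqrt (by positivity)]
  exact hf.grad_lipschitz x x' y y'

theorem norm_hess_sub_le (x x' : Vec dx) (y y' : Vec dy) :
    ‖hess f x y - hess f x' y'‖ ≤ ρ * √(‖x - x'‖ ^ 2 + ‖y - y'‖ ^ 2) := by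
  have := hf.rho_pos
  refine le_of_sq_le_sq ?_ (by positivity)
  rw [mul_pow, Real.sq_sqrt (by positivity)]
  exact hf.hess_lipschitz x x' y y'

theorem norm_hess_le (x : Vec dx) (y : Vec dy) : ‖hess f x y‖ ≤ ℓ := by
  have hL : LipschitzWith ⟨ℓ, hf.ell_pos.le⟩ (gradient (joint f)) := by
    refine LipschitzWith.of_dist_le_mul fun z w => ?_
    rw [dist_eq_norm, dist_eq_norm, WithLp.prod_norm_eq_of_L2 (z - w)]
    exact hf.norm_grad_sub_le z.fst w.fst z.snd w.snd
  exact norm_fderiv_le_of_lipschitz ℝ hL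

theorem norm_gradX_sub_le (x : Vec dx) (y y' : Vec dy) :
    ‖gradX f x y - gradX f x y'‖ ≤ ℓ * ‖y - y'‖ := by
  rw [hf.gradX_eq, hf.gradX_eq, ← WithLp.sub_fst]
  refine (WithLp.norm_fst_le _ _).trans ((hf.norm_grad_sub_le x x y y').trans_eq ?_)
  simp [Real.sqrt_sq]

theorem norm_gradY_sub_le (x x' : Vec dx) (y y' : Vec dy) :
    ‖gradY f x y - gradY f x' y'‖ ≤ ℓ * √(‖x - x'‖ ^ 2 + ‖y - y'‖ ^ 2) := by
  rw [hf.gradY_eq, hf.gradY_eq, ← WithLp.sub_snd]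
  exact (WithLp.norm_snd_le _ _).trans (hf.norm_grad_sub_le x x' y y')

/-- Strong monotonicity of `-∇_y f(x, ·)`. -/
theorem inner_gradY_sub_le (x : Vec dx) (y y' : Vec dy) :
    inner ℝ (gradY f x y - gradY f x y') (y - y') ≤ -(μ * ‖y - y'‖ ^ 2) := by
  have h1 := hf.strongly_concave x y y'
  have h2 := hf.strongly_concave x y' y
  rw [← neg_sub y y', inner_neg_right, norm_neg] at h2
  rw [inner_sub_left]
  linarith

theorem mu_le_ell (hdy : 1 ≤ dy) : μ ≤ ℓ := by
  have : Nonempty (Fin dy) := ⟨⟨0, hdy⟩⟩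
  obtain ⟨v, hv⟩ := exists_ne (0 : Vec dy)
  have hv' : 0 < ‖v‖ := norm_pos_iff.2 hv
  have h1 := hf.inner_gradY_sub_le 0 v 0
  have h2 := hf.norm_gradY_sub_le 0 0 v 0
  have h3 := abs_le.1 (abs_real_inner_le_norm (gradY f 0 v - gradY f 0 0) (v - 0))
  simp only [sub_zero, sub_self, norm_zero, ne_eq, OfNat.ofNat_ne_zero, not_false_eq_true,
    zero_pow, zero_add, Real.sqrt_sq (norm_nonneg v)] at h1 h2 h3
  have h4 : μ * ‖v‖ ^ 2 ≤ ℓ * ‖v‖ ^ 2 := by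
    have := mul_le_mul_of_nonneg_right h2 hv'.le
    nlinarith [h3.1]
  exact le_of_mul_le_mul_right h4 (by positivity)

/-- The block `∇²_{yy}f` is bounded above by `-μ`. -/
theorem inner_hessYY_le (x : Vec dx) (y w : Vec dy) :
    inner ℝ w (hessYY f x y w) ≤ -(μ * ‖w‖ ^ 2) := by
  have hline : HasDerivAt (fun t : ℝ => y + t • w) w 0 := by
    simpa using ((hasDerivAt_id (0 : ℝ)).smul_const w).const_add y
  have h0 : HasFDerivAt (fun y' => gradY f x y') (hessYY f x y) (y + (0 : ℝ) • w) := by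
    simpa using hf.hasFDerivAt_gradY x y
  have h1 := h0.comp_hasDerivAt (0 : ℝ) hline
  rw [hasDerivAt_iff_tendsto_slope_zero] at h1
  have h2 : Tendsto (fun t : ℝ => inner ℝ w (t⁻¹ • (gradY f x (y + t • w) - gradY f x y)))
      (𝓝[≠] 0) (𝓝 (inner ℝ w (hessYY f x y w))) := by
    have := (tendsto_const_nhds (x := w)).inner (𝕜 := ℝ) h1
    simpa using this
  refine le_of_tendsto h2 ?_
  filter_upwards [self_mem_nhdsWithin] with t ht
  have ht : t ≠ 0 := ht
  have h3 := hf.inner_gradY_sub_le x (y + t • w) y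
  rw [add_sub_cancel_left, inner_smul_right, norm_smul, mul_pow, Real.norm_eq_abs, sq_abs] at h3
  rw [inner_smul_right, real_inner_comm]
  have h4 : t⁻¹ * inner ℝ (gradY f x (y + t • w) - gradY f x y) w
      = (t ^ 2)⁻¹ * (t * inner ℝ (gradY f x (y + t • w) - gradY f x y) w) := by
    field_simp
  rw [h4]
  have h5 : 0 < t ^ 2 := by positivity
  rw [inv_mul_le_iff₀ h5]
  linarith

theorem hessYY_isInvertible (x : Vec dx) (y : Vec dy) : (hessYY f x y).IsInvertible := by
  have hinj : Function.Injective (hessYY f x y : Vec dy →ₗ[ℝ] Vec dy) := by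
    rw [injective_iff_map_eq_zero]
    intro w hw
    have h1 := hf.inner_hessYY_le x y w
    have hw' : hessYY f x y w = 0 := hw
    rw [hw', inner_zero_right] at h1
    have : ‖w‖ ^ 2 = 0 := by
      have := hf.mu_pos
      nlinarith [sq_nonneg ‖w‖]
    simpa using this
  exact ⟨(LinearEquiv.ofInjectiveEndo _ hinj).toContinuousLinearEquiv, by ext; rfl⟩

end Assumptions

end Blocks

section

variable {dx dy : ℕ} {f : Vec dx → Vec dy → ℝ} {ℓ ρ μ : ℝ}

/-! ### The Schur complement of the Hessian -/

section Schur

/-- The maximiser `w = -(∇²_{yy}f)⁻¹ ∇²_{yx}f s` of the quadratic form of the full Hessian at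
`(s, w)`, as a function of `s`. -/
noncomputable def schurArg (f : Vec dx → Vec dy → ℝ) (x : Vec dx) (y : Vec dy) :
    Vec dx →L[ℝ] Vec dy :=
  -((hessYY f x y).inverse.comp (hessYX f x y))

namespace Assumptions

variable (hf : Assumptions f ℓ ρ μ)
include hf

/-- The full Hessian maps `(s, schurArg s)` to `(S s, 0)`, with `S` the Schur complement. -/
theorem hess_schurArg (x : Vec dx) (y : Vec dy) (s : Vec dx) :
    hess f x y (inlL dx dy s + inrL dx dy (schurArg f x y s)) = inlL dx dy (schurHess f x y s) := by
  have hinv : hessYY f x y ((hessYY f x y).inverse (hessYX f x y s)) = hessYX f x y s :=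
    ((hf.hessYY_isInvertible x y).inverse_apply_eq.1 rfl).symm
  have h1 : (hess f x y (inlL dx dy s + inrL dx dy (schurArg f x y s))).fst
      = schurHess f x y s := by
    rw [map_add, WithLp.add_fst, ← hf.hessXX_apply, ← hf.hessXY_apply]
    simp [schurArg, schurHess, sub_eq_add_neg]
  have h2 : (hess f x y (inlL dx dy s + inrL dx dy (schurArg f x y s))).snd = 0 := by
    rw [map_add, WithLp.add_snd, ← hf.hessYX_apply, ← hf.hessYY_apply]
    simp [schurArg, hinv]
  have h3 : ∀ z : WithLp 2 (Vec dx × Vec dy), z = WithLp.toLp 2 (z.fst, z.snd) := fun _ => rfl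
  rw [h3 (hess f x y _), h1, h2, inlL_apply]

theorem inner_schurHess (x : Vec dx) (y : Vec dy) (s s' : Vec dx) (w : Vec dy) :
    inner ℝ s (schurHess f x y s') = inner ℝ (inlL dx dy s + inrL dx dy w)
      (hess f x y (inlL dx dy s' + inrL dx dy (schurArg f x y s'))) := by
  rw [hf.hess_schurArg, inner_inlL, inlL_add_inrL]; rfl

theorem isSelfAdjoint_schurHess (x : Vec dx) (y : Vec dy) : IsSelfAdjoint (schurHess f x y) := by
  rw [ContinuousLinearMap.isSelfAdjoint_iff_isSymmetric]
  intro s s'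
  change inner ℝ (schurHess f x y s) s' = inner ℝ s (schurHess f x y s')
  rw [hf.inner_schurHess x y s s' (schurArg f x y s), ← hf.inner_hess_comm, real_inner_comm,
    hf.inner_schurHess x y s' s (schurArg f x y s'), real_inner_comm]

/-- Variational characterisation of the Schur complement: its quadratic form at `s` is the maximum
over `w` of the quadratic form of the full Hessian at `(s, w)`. -/
theorem inner_hess_le_inner_schurHess (x : Vec dx) (y : Vec dy) (s : Vec dx) (w : Vec dy) :
    inner ℝ (inlL dx dy s + inrL dx dy w) (hess f x y (inlL dx dy s + inrL dx dy w))
      ≤ inner ℝ s (schurHess f x y s) := by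
  set w₀ := schurArg f x y s with hw₀
  set z := inlL dx dy s + inrL dx dy w₀ with hz
  have e : inlL dx dy s + inrL dx dy w = z + inrL dx dy (w - w₀) := by
    rw [hz, map_sub]; abel
  have h1 : inner ℝ (z + inrL dx dy (w - w₀)) (hess f x y z) = inner ℝ s (schurHess f x y s) := by
    rw [← e, hf.inner_schurHess x y s s w]
  have h2 : inner ℝ z (hess f x y (inrL dx dy (w - w₀))) = 0 := by
    rw [← hf.inner_hess_comm, hz, hw₀, hf.hess_schurArg, inlL_apply, inrL_apply]
    simp [WithLp.prod_inner_apply]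
  have h3 : inner ℝ (inrL dx dy (w - w₀)) (hess f x y (inrL dx dy (w - w₀))) ≤ 0 := by
    rw [real_inner_comm, inner_inrL, ← hf.hessYY_apply, real_inner_comm]
    refine (hf.inner_hessYY_le x y _).trans ?_
    have := hf.mu_pos
    rw [neg_nonpos]; positivity
  rw [e, map_add, inner_add_right, h1, inner_add_left, h2]
  linarith

theorem norm_schurArg_le (x : Vec dx) (y : Vec dy) (s : Vec dx) :
    ‖schurArg f x y s‖ ≤ ℓ / μ * ‖s‖ := by
  have hμ := hf.mu_pos
  set w := schurArg f x y s with hw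
  have h1 := hf.inner_hessYY_le x y w
  have h2 : hessYY f x y w = -hessYX f x y s := by
    have hinv : hessYY f x y ((hessYY f x y).inverse (hessYX f x y s)) = hessYX f x y s :=
      ((hf.hessYY_isInvertible x y).inverse_apply_eq.1 rfl).symm
    simp [hw, schurArg, hinv]
  have h3 : ‖hessYX f x y s‖ ≤ ℓ * ‖s‖ := by
    rw [hf.hessYX_apply]
    refine (WithLp.norm_snd_le _ _).trans ?_
    refine ((hess f x y).le_of_opNorm_le (hf.norm_hess_le x y) _).trans_eq ?_
    rw [norm_inlL]
  have h4 := real_inner_le_norm w (hessYX f x y s)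
  rw [h2, inner_neg_right] at h1
  rcases (norm_nonneg w).eq_or_lt with h0 | h0
  · rw [← h0]; have := hf.ell_pos; positivity
  · have h5 : μ * ‖w‖ * ‖w‖ ≤ (ℓ * ‖s‖) * ‖w‖ := by
      have := mul_le_mul_of_nonneg_left h3 h0.le
      nlinarith
    have h6 := le_of_mul_le_mul_right h5 h0
    rw [div_mul_eq_mul_div, le_div_iff₀ hμ]; linarith

theorem neg_ell_le_inner_schurHess (x : Vec dx) (y : Vec dy) (s : Vec dx) :
    -(ℓ * ‖s‖ ^ 2) ≤ inner ℝ s (schurHess f x y s) := by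
  refine le_trans ?_ (hf.inner_hess_le_inner_schurHess x y s 0)
  rw [map_zero, add_zero]
  have h1 := abs_le.1 (abs_real_inner_le_norm (inlL dx dy s) (hess f x y (inlL dx dy s)))
  have h2 := (hess f x y).le_of_opNorm_le (hf.norm_hess_le x y) (inlL dx dy s)
  rw [norm_inlL] at h1 h2
  nlinarith [h1.1, norm_nonneg s]

theorem inner_schurHess_le (x : Vec dx) (y : Vec dy) (s : Vec dx) :
    inner ℝ s (schurHess f x y s) ≤ (1 + ℓ / μ) * ℓ * ‖s‖ ^ 2 := by
  have h0 := hf.inner_schurHess x y s s 0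
  rw [map_zero, add_zero] at h0
  rw [h0]
  have hℓ := hf.ell_pos
  have h2 := (hess f x y).le_of_opNorm_le (hf.norm_hess_le x y)
    (inlL dx dy s + inrL dx dy (schurArg f x y s))
  have h3 := norm_add_le (inlL dx dy s) (inrL dx dy (schurArg f x y s))
  rw [norm_inlL, norm_inrL] at h3
  have h4 := hf.norm_schurArg_le x y s
  calc inner ℝ (inlL dx dy s) (hess f x y (inlL dx dy s + inrL dx dy (schurArg f x y s)))
      ≤ ‖inlL dx dy s‖ * ‖hess f x y (inlL dx dy s + inrL dx dy (schurArg f x y s))‖ :=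
        real_inner_le_norm _ _
    _ ≤ ‖s‖ * (ℓ * (‖s‖ + ℓ / μ * ‖s‖)) := by
        rw [norm_inlL]
        gcongr
        exact h2.trans (by gcongr; linarith)
    _ = (1 + ℓ / μ) * ℓ * ‖s‖ ^ 2 := by ring

theorem inner_schurHess_sub_le {D : ℝ} {x x' : Vec dx} {y y' : Vec dy}
    (hD : ‖hess f x y - hess f x' y'‖ ≤ D) (s : Vec dx) :
    inner ℝ s (schurHess f x y s) - inner ℝ s (schurHess f x' y' s)
      ≤ (1 + (ℓ / μ) ^ 2) * D * ‖s‖ ^ 2 := by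
  set w := schurArg f x y s with hw
  set z := inlL dx dy s + inrL dx dy w with hz
  have h1 := hf.inner_schurHess x y s s w
  have h2 := hf.inner_hess_le_inner_schurHess x' y' s w
  rw [← hw, ← hz] at h1
  rw [← hz] at h2
  have h3 : ‖z‖ ^ 2 ≤ (1 + (ℓ / μ) ^ 2) * ‖s‖ ^ 2 := by
    have : ‖w‖ ^ 2 ≤ (ℓ / μ * ‖s‖) ^ 2 := by gcongr; exact hf.norm_schurArg_le x y s
    rw [hz, inlL_add_inrL, WithLp.prod_norm_sq_eq_of_L2]
    simp only [WithLp.toLp_fst, WithLp.toLp_snd]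
    linarith
  have h4 : inner ℝ z ((hess f x y - hess f x' y') z) ≤ D * ‖z‖ ^ 2 := by
    have h5 := (hess f x y - hess f x' y').le_of_opNorm_le hD z
    have h6 := real_inner_le_norm z ((hess f x y - hess f x' y') z)
    nlinarith [norm_nonneg z]
  rw [sub_apply, inner_sub_right] at h4
  have hD0 : 0 ≤ D := (norm_nonneg _).trans hD
  have h7 := mul_le_mul_of_nonneg_left h3 hD0
  linarith

/-- The Schur complement is Lipschitz as a function of the full Hessian. -/
theorem norm_schurHess_sub_le {D : ℝ} {x x' : Vec dx} {y y' : Vec dy}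
    (hD : ‖hess f x y - hess f x' y'‖ ≤ D) :
    ‖schurHess f x y - schurHess f x' y'‖ ≤ (1 + (ℓ / μ) ^ 2) * D := by
  have hD0 : 0 ≤ D := (norm_nonneg _).trans hD
  refine norm_le_of_abs_inner_le ((hf.isSelfAdjoint_schurHess x y).sub
    (hf.isSelfAdjoint_schurHess x' y')) (by positivity) fun s => ?_
  rw [sub_apply, inner_sub_right, abs_le]
  have h1 := hf.inner_schurHess_sub_le hD s
  rw [norm_sub_rev] at hD
  have h2 := hf.inner_schurHess_sub_le hD s
  constructor <;> linarith

/-- All Schur complements lie between `-ℓ` and `(1 + κ) ℓ`. -/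
theorem norm_schurHess_sub_le_const (x x' : Vec dx) (y y' : Vec dy) :
    ‖schurHess f x y - schurHess f x' y'‖ ≤ (2 + ℓ / μ) * ℓ := by
  have hℓ := hf.ell_pos
  have hμ := hf.mu_pos
  refine norm_le_of_abs_inner_le ((hf.isSelfAdjoint_schurHess x y).sub
    (hf.isSelfAdjoint_schurHess x' y')) (by positivity) fun s => ?_
  rw [sub_apply, inner_sub_right, abs_le]
  have h1 := hf.neg_ell_le_inner_schurHess x y s
  have h2 := hf.neg_ell_le_inner_schurHess x' y' s
  have h3 := hf.inner_schurHess_le x y s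
  have h4 := hf.inner_schurHess_le x' y' s
  constructor <;> linarith

end Assumptions

end Schur

/-! ### Derivatives of the primal function -/

section Primal

namespace Assumptions

variable (hf : Assumptions f ℓ ρ μ)
include hf

theorem exists_forall_le (x : Vec dx) : ∃ y, ∀ y', f x y' ≤ f x y := by
  have hμ := hf.mu_pos
  set g := gradY f x 0
  set R := 2 * ‖g‖ / μ with hR
  have hcont : Continuous (fun y => f x y) := continuous_iff_continuousAt.2 fun y =>
    (hf.hasGradientAt_right x y).continuousAt
  have hR0 : 0 ≤ R := by positivity
  obtain ⟨y, -, hy⟩ := (isCompact_closedBall (0 : Vec dy) R).exists_isMaxOn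
    ⟨0, by simpa using hR0⟩ hcont.continuousOn
  refine ⟨y, fun y' => ?_⟩
  by_cases h : y' ∈ Metric.closedBall (0 : Vec dy) R
  · exact hy h
  · refine le_trans ?_ (hy (show (0 : Vec dy) ∈ Metric.closedBall 0 R by simpa using hR0))
    have h1 := hf.strongly_concave x y' 0
    rw [sub_zero] at h1
    have h2 := real_inner_le_norm g y'
    have h3 : R < ‖y'‖ := by simpa using h
    rw [hR, div_lt_iff₀ hμ] at h3
    have : (0 : ℝ) ≤ ‖y'‖ := norm_nonneg _
    change f x y' ≤ f x 0
    nlinarith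

theorem le_yStar (x : Vec dx) (y : Vec dy) : f x y ≤ f x (yStar f x) :=
  Classical.epsilon_spec (hf.exists_forall_le x) y

theorem primal_eq (x : Vec dx) : primal f x = f x (yStar f x) :=
  le_antisymm (ciSup_le (hf.le_yStar x)) (le_ciSup (f := fun y => f x y)
    ⟨f x (yStar f x), by rintro _ ⟨y, rfl⟩; exact hf.le_yStar x y⟩ (yStar f x))

theorem primalInf_le (x : Vec dx) : primalInf f ≤ primal f x :=
  ciInf_le hf.primal_bddBelow x

theorem gradY_yStar (x : Vec dx) : gradY f x (yStar f x) = 0 := by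
  have hmax : IsLocalMax (fun y => f x y) (yStar f x) := Eventually.of_forall (hf.le_yStar x)
  have h1 := hmax.hasFDerivAt_eq_zero (hf.hasGradientAt_right x _).hasFDerivAt
  rw [hf.gradY_eq]
  simpa using h1

theorem norm_yStar_sub_le (x x' : Vec dx) : ‖yStar f x - yStar f x'‖ ≤ ℓ / μ * ‖x - x'‖ := by
  have hμ := hf.mu_pos
  have h1 := hf.inner_gradY_sub_le x' (yStar f x) (yStar f x')
  have h2 := hf.norm_gradY_sub_le x' x (yStar f x) (yStar f x)
  rw [hf.gradY_yStar x', sub_zero] at h1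
  rw [hf.gradY_yStar x, sub_zero, sub_self, norm_zero, norm_sub_rev] at h2
  simp only [ne_eq, OfNat.ofNat_ne_zero, not_false_eq_true, zero_pow, add_zero,
    Real.sqrt_sq (norm_nonneg _)] at h2
  have h3 := abs_le.1 (abs_real_inner_le_norm (gradY f x' (yStar f x)) (yStar f x - yStar f x'))
  rcases (norm_nonneg (yStar f x - yStar f x')).eq_or_lt with h0 | h0
  · rw [← h0]; have := hf.ell_pos; positivity
  · have h5 : μ * ‖yStar f x - yStar f x'‖ * ‖yStar f x - yStar f x'‖
        ≤ (ℓ * ‖x - x'‖) * ‖yStar f x - yStar f x'‖ := by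
      have := mul_le_mul_of_nonneg_right h2 h0.le
      linarith [h3.1]
    have h6 := le_of_mul_le_mul_right h5 h0
    rw [div_mul_eq_mul_div, le_div_iff₀ hμ]; linarith

/-- Implicit differentiation of `∇_y f(x, y*(x)) = 0`. The Lipschitz bound on `y*` turns the
first-order expansion of the gradient into one of `y*`. -/
theorem hasFDerivAt_yStar (x : Vec dx) :
    HasFDerivAt (yStar f) (schurArg f x (yStar f x)) x := by
  set y := yStar f x with hy
  set z : Vec dx → WithLp 2 (Vec dx × Vec dy) := fun x' => WithLp.toLp 2 (x', yStar f x') with hz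
  have hκ : 0 ≤ ℓ / μ := div_nonneg hf.ell_pos.le hf.mu_pos.le
  have hbound : ∀ x', ‖z x' - z x‖ ≤ (1 + ℓ / μ) * ‖x' - x‖ := by
    intro x'
    have e : z x' - z x = inlL dx dy (x' - x) + inrL dx dy (yStar f x' - yStar f x) := by
      rw [inlL_add_inrL, hz, ← WithLp.toLp_sub]; rfl
    rw [e]
    refine (norm_add_le _ _).trans ?_
    rw [norm_inlL, norm_inrL]
    linarith [hf.norm_yStar_sub_le x' x]
  have hO : (fun x' => z x' - z x) =O[𝓝 x] fun x' => x' - x :=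
    Asymptotics.IsBigO.of_bound _ (Eventually.of_forall hbound)
  have htend : Tendsto z (𝓝 x) (𝓝 (z x)) := by
    rw [tendsto_iff_norm_sub_tendsto_zero]
    refine squeeze_zero (fun _ => norm_nonneg _) hbound ?_
    have : Tendsto (fun x' : Vec dx => (1 + ℓ / μ) * ‖x' - x‖) (𝓝 x)
        (𝓝 ((1 + ℓ / μ) * ‖x - x‖)) := by
      apply Continuous.tendsto; fun_prop
    simpa using this
  have h1 := ((hf.hasFDerivAt_gradient_joint x y).isLittleO.comp_tendsto htend).trans_isBigO hO
  have h2 := ((hessYY f x y).inverse.comp (WithLp.sndL 2 ℝ (Vec dx) (Vec dy))).isBigO_comp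
    (fun x' => gradient (joint f) (z x') - gradient (joint f) (z x)
      - hess f x y (z x' - z x)) (𝓝 x)
  have h3 := h2.trans_isLittleO h1
  rw [hasFDerivAt_iff_isLittleO]
  refine h3.neg_left.congr_left fun x' => ?_
  have e1 : (gradient (joint f) (z x')).snd = 0 :=
    (hf.gradY_eq x' _).symm.trans (hf.gradY_yStar x')
  have e2 : (gradient (joint f) (z x)).snd = 0 :=
    (hf.gradY_eq x _).symm.trans (hf.gradY_yStar x)
  have e3 : z x' - z x = inlL dx dy (x' - x) + inrL dx dy (yStar f x' - yStar f x) := by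
    rw [inlL_add_inrL, hz, ← WithLp.toLp_sub]; rfl
  have e4 : (hess f x y (z x' - z x)).snd
      = hessYX f x y (x' - x) + hessYY f x y (yStar f x' - yStar f x) := by
    rw [e3, map_add, WithLp.add_snd, ← hf.hessYX_apply, ← hf.hessYY_apply]
  have e5 : (hessYY f x y).inverse (hessYY f x y (yStar f x' - yStar f x))
      = yStar f x' - yStar f x :=
    (hf.hessYY_isInvertible x y).inverse_apply_eq.2 rfl
  change -((hessYY f x y).inverse ((gradient (joint f) (z x') - gradient (joint f) (z x)
      - hess f x y (z x' - z x)).snd)) = _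
  rw [WithLp.sub_snd, WithLp.sub_snd, e1, e2, e4, sub_zero, zero_sub, map_neg, neg_neg, map_add, e5]
  simp [schurArg]
  abel

theorem hasFDerivAt_toLp_yStar (x : Vec dx) :
    HasFDerivAt (fun x' => (WithLp.toLp 2 (x', yStar f x') : WithLp 2 (Vec dx × Vec dy)))
      (inlL dx dy + (inrL dx dy).comp (schurArg f x (yStar f x))) x :=
  (hasFDerivAt_toLp (hasFDerivAt_id x) (hf.hasFDerivAt_yStar x)).congr_fderiv (by ext; simp)

/-- Danskin's theorem: `∇P(x) = ∇ₓf(x, y*(x))`. -/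
theorem hasGradientAt_primal (x : Vec dx) :
    HasGradientAt (primal f) (gradX f x (yStar f x)) x := by
  have h1 := (hf.hasGradientAt_joint _).hasFDerivAt.comp x (hf.hasFDerivAt_toLp_yStar x)
  have h2 : primal f = joint f ∘ fun x' => WithLp.toLp 2 (x', yStar f x') := by
    funext x'; exact hf.primal_eq x'
  rw [hasGradientAt_iff_hasFDerivAt, h2]
  refine h1.congr_fderiv ?_
  ext1 v
  change inner ℝ (grad f x (yStar f x)) (inlL dx dy v + inrL dx dy (schurArg f x (yStar f x) v))
    = inner ℝ (gradX f x (yStar f x)) v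
  rw [inner_add_right, inner_inlL, inner_inrL, ← hf.gradX_eq, ← hf.gradY_eq, hf.gradY_yStar]
  simp

theorem gradient_primal : gradient (primal f) = fun x => gradX f x (yStar f x) :=
  funext fun x => (hf.hasGradientAt_primal x).gradient

/-- `∇²P(x)` is the Schur complement at `(x, y*(x))`. -/
theorem hasFDerivAt_gradient_primal (x : Vec dx) :
    HasFDerivAt (gradient (primal f)) (schurHess f x (yStar f x)) x := by
  have h1 := (WithLp.fstL 2 ℝ (Vec dx) (Vec dy)).hasFDerivAt.comp x
    ((hf.hasFDerivAt_gradient_joint x (yStar f x)).comp x (hf.hasFDerivAt_toLp_yStar x))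
  have h2 : gradient (primal f) = (WithLp.fstL 2 ℝ (Vec dx) (Vec dy)) ∘
      (gradient (joint f) ∘ fun x' => (WithLp.toLp 2 (x', yStar f x'))) := by
    rw [hf.gradient_primal]; funext x'; exact hf.gradX_eq x' _
  rw [h2]
  refine h1.congr_fderiv ?_
  ext1 v
  change (hess f x (yStar f x) (inlL dx dy v + inrL dx dy (schurArg f x (yStar f x) v))).fst
    = schurHess f x (yStar f x) v
  rw [hf.hess_schurArg]; rfl

/-- `∇²P` is Lipschitz with half of the constant `M = 4√2 κ³ρ` used by the cubic model. -/
theorem norm_hessian_primal_sub_le (hdy : 1 ≤ dy) (x x' : Vec dx) :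
    ‖schurHess f x (yStar f x) - schurHess f x' (yStar f x')‖
      ≤ cubicM (ℓ / μ) ρ / 2 * ‖x - x'‖ := by
  have hρ := hf.rho_pos
  set κ := ℓ / μ with hκdef
  have hκ : 1 ≤ κ := (one_le_div hf.mu_pos).2 (hf.mu_le_ell hdy)
  have h1 : √(‖x - x'‖ ^ 2 + ‖yStar f x - yStar f x'‖ ^ 2) ≤ √2 * κ * ‖x - x'‖ := by
    rw [Real.sqrt_le_left (by positivity)]
    have h2 : ‖yStar f x - yStar f x'‖ ^ 2 ≤ (κ * ‖x - x'‖) ^ 2 := by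
      gcongr; exact hf.norm_yStar_sub_le x x'
    rw [mul_pow, mul_pow, Real.sq_sqrt zero_le_two]
    have h3 : 1 * ‖x - x'‖ ^ 2 ≤ κ ^ 2 * ‖x - x'‖ ^ 2 := by
      gcongr; exact one_le_pow₀ hκ
    linarith
  have h4 := hf.norm_hess_sub_le x x' (yStar f x) (yStar f x')
  have h5 : ‖hess f x (yStar f x) - hess f x' (yStar f x')‖ ≤ ρ * (√2 * κ * ‖x - x'‖) :=
    h4.trans (by gcongr)
  refine (hf.norm_schurHess_sub_le h5).trans ?_
  rw [← hκdef]
  have h6 : 1 + κ ^ 2 ≤ 2 * κ ^ 2 := by nlinarith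
  calc (1 + κ ^ 2) * (ρ * (√2 * κ * ‖x - x'‖))
      ≤ (2 * κ ^ 2) * (ρ * (√2 * κ * ‖x - x'‖)) := by gcongr
    _ = cubicM κ ρ / 2 * ‖x - x'‖ := by rw [cubicM]; ring

end Assumptions

end Primal

end

/-! ### One inexact cubic Newton step -/

section CubicStep

variable {n : ℕ} {P : Vec n → ℝ} {G : Vec n → Vec n} {Q : Vec n → Vec n →L[ℝ] Vec n} {M q : ℝ}
  {g x s : Vec n} {H : Vec n →L[ℝ] Vec n}

/-- A long inexact cubic Newton step decreases the objective. The errors are measured in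
`q = √(ε/M)`, so that `ε = M q²` and `√(M ε) = M q`. The Hessian of `P` is Lipschitz with constant
`M/2` only, and this slack in the cubic model pays for the errors. -/
theorem cubic_step_descent (hM : 0 < M) (hq : 0 < q)
    (hG : ∀ z, HasGradientAt P (G z) z) (hQ : ∀ z, HasFDerivAt G (Q z) z)
    (hlip : ∀ z w, ‖Q z - Q w‖ ≤ M / 2 * ‖z - w‖)
    (hH : IsSelfAdjoint H) (hg : ‖g - G x‖ ≤ M * q ^ 2 / 192) (hHQ : ‖H - Q x‖ ≤ M * q / 12)
    (hs : ∀ u, cubicModel g H M s ≤ cubicModel g H M u) (hlong : q / 2 < ‖s‖) :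
    P (x + s) ≤ P x - M / 16 * ‖s‖ ^ 3 := by
  have hr : 0 < ‖s‖ := by linarith
  have h1 := le_cubic_of_lipschitz_hessian hG hQ hlip x s
  have h2 : inner ℝ (g + H s + (M / 2 * ‖s‖) • s) s = 0 := by
    rw [cubicModel_first_order hH hM hs, inner_zero_left]
  have h3 := cubicModel_second_order hH hM hs s
  rw [inner_add_left, inner_add_left, inner_smul_left, real_inner_self_eq_norm_sq,
    real_inner_comm s (H s)] at h2
  simp only [conj_trivial] at h2
  have h4 : inner ℝ (G x) s ≤ inner ℝ g s + M * q ^ 2 / 192 * ‖s‖ := by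
    have := abs_le.1 (abs_real_inner_le_norm (g - G x) s)
    rw [inner_sub_left] at this
    have := mul_le_mul_of_nonneg_right hg hr.le
    linarith
  have h5 : inner ℝ s (Q x s) ≤ inner ℝ s (H s) + M * q / 12 * ‖s‖ ^ 2 := by
    have h6 := abs_le.1 (abs_real_inner_le_norm s ((H - Q x) s))
    have h7 := (H - Q x).le_of_opNorm_le hHQ s
    rw [sub_apply, inner_sub_right] at h6
    have := mul_le_mul_of_nonneg_left h7 hr.le
    simp only [sub_apply] at this
    nlinarith
  have h8 : M * q ^ 2 * ‖s‖ ≤ 4 * (M * ‖s‖ ^ 3) := by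
    have : q ^ 2 ≤ (2 * ‖s‖) ^ 2 := by gcongr; linarith
    calc M * q ^ 2 * ‖s‖ ≤ M * (2 * ‖s‖) ^ 2 * ‖s‖ := by gcongr
      _ = 4 * (M * ‖s‖ ^ 3) := by ring
  have h9 : M * q * ‖s‖ ^ 2 ≤ 2 * (M * ‖s‖ ^ 3) := by
    calc M * q * ‖s‖ ^ 2 ≤ M * (2 * ‖s‖) * ‖s‖ ^ 2 := by gcongr; linarith
      _ = 2 * (M * ‖s‖ ^ 3) := by ring
  have h10 : 0 < M * ‖s‖ ^ 3 := by positivity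
  nlinarith

theorem cubic_step_gradient (hM : 0 < M) (hq : 0 < q) (hQ : ∀ z, HasFDerivAt G (Q z) z)
    (hlip : ∀ z w, ‖Q z - Q w‖ ≤ M / 2 * ‖z - w‖)
    (hH : IsSelfAdjoint H) (hg : ‖g - G x‖ ≤ M * q ^ 2 / 192) (hHQ : ‖H - Q x‖ ≤ M * q / 12)
    (hs : ∀ u, cubicModel g H M s ≤ cubicModel g H M u) (hshort : ‖s‖ ≤ q / 2) :
    ‖G (x + s)‖ ≤ M * q ^ 2 := by
  have h1 := norm_sub_sub_le_of_lipschitz_fderiv hQ hlip x s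
  have h2 := cubicModel_first_order hH hM hs
  have h3 : G (x + s) = (G (x + s) - G x - Q x s) - (g - G x) - (H - Q x) s
      - (M / 2 * ‖s‖) • s := by
    have h4 : g + H s = -((M / 2 * ‖s‖) • s) := eq_neg_of_add_eq_zero_left h2
    have h5 : (G (x + s) - G x - Q x s) - (g - G x) - (H - Q x) s - (M / 2 * ‖s‖) • s
        = G (x + s) - (g + H s) - (M / 2 * ‖s‖) • s := by
      rw [sub_apply]; abel
    rw [h5, h4]; abel
  have h4 : ‖(H - Q x) s‖ ≤ M * q / 12 * ‖s‖ := (H - Q x).le_of_opNorm_le hHQ s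
  have h5 : ‖(M / 2 * ‖s‖) • s‖ = M / 2 * ‖s‖ ^ 2 := by
    rw [norm_smul, Real.norm_of_nonneg (by positivity)]; ring
  have h6 : ‖G (x + s)‖ ≤ ‖G (x + s) - G x - Q x s‖ + ‖g - G x‖ + ‖(H - Q x) s‖
      + ‖(M / 2 * ‖s‖) • s‖ := by
    conv_lhs => rw [h3]
    refine (norm_sub_le _ _).trans (add_le_add_left ?_ _)
    refine (norm_sub_le _ _).trans (add_le_add_left ?_ _)
    exact norm_sub_le _ _
  have h7 : M * ‖s‖ ^ 2 ≤ M * q ^ 2 / 4 := by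
    calc M * ‖s‖ ^ 2 ≤ M * (q / 2) ^ 2 := by gcongr
      _ = M * q ^ 2 / 4 := by ring
  have h8 : M * q / 12 * ‖s‖ ≤ M * q / 12 * (q / 2) := by gcongr
  have h9 : 0 < M * q ^ 2 := by positivity
  rw [h5] at h6
  linarith

theorem cubic_step_hessian (hM : 0 < M) (hq : 0 < q)
    (hlip : ∀ z w, ‖Q z - Q w‖ ≤ M / 2 * ‖z - w‖)
    (hH : IsSelfAdjoint H) (hHQ : ‖H - Q x‖ ≤ M * q / 12)
    (hs : ∀ u, cubicModel g H M s ≤ cubicModel g H M u) (hshort : ‖s‖ ≤ q / 2) (v : Vec n) :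
    -(M * q) * ‖v‖ ^ 2 ≤ inner ℝ v (Q (x + s) v) := by
  have h1 := cubicModel_second_order hH hM hs v
  have h2 : ‖H - Q (x + s)‖ ≤ M * q / 12 + M / 2 * ‖s‖ := by
    have h3 := hlip x (x + s)
    have h4 : ‖x - (x + s)‖ = ‖s‖ := by rw [norm_sub_rev, add_sub_cancel_left]
    rw [h4] at h3
    exact (norm_sub_le_norm_sub_add_norm_sub H (Q x) _).trans (add_le_add hHQ h3)
  have h5 := (H - Q (x + s)).le_of_opNorm_le h2 v
  have h6 := abs_le.1 (abs_real_inner_le_norm v ((H - Q (x + s)) v))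
  have h7 := mul_le_mul_of_nonneg_left h5 (norm_nonneg v)
  rw [sub_apply, inner_sub_right] at h6
  simp only [sub_apply] at h7
  have h8 : M * ‖s‖ * ‖v‖ ^ 2 ≤ M * (q / 2) * ‖v‖ ^ 2 := by gcongr
  have h9 : 0 ≤ M * q * ‖v‖ ^ 2 := by positivity
  nlinarith [h6.2]

end CubicStep

/-! ### Accuracy of the gradient and Hessian oracles -/

section Oracle

variable {dx dy : ℕ} {f : Vec dx → Vec dy → ℝ} {ℓ ρ μ : ℝ}

namespace Assumptions

variable (hf : Assumptions f ℓ ρ μ)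
include hf

theorem norm_gradX_sub_le_of_epsTilde {M e : ℝ} {x : Vec dx} {y : Vec dy}
    (hy : ‖y - yStar f x‖ ≤ epsTilde ℓ ρ M e) :
    ‖gradX f x y - gradX f x (yStar f x)‖ ≤ e / 192 := by
  have hℓ := hf.ell_pos
  refine (hf.norm_gradX_sub_le x _ _).trans ?_
  calc ℓ * ‖y - yStar f x‖ ≤ ℓ * (1 / 192 * e / ℓ) := by
        gcongr; exact hy.trans (min_le_left _ _)
    _ = e / 192 := by field_simp

/-- Error of the inexact Hessian. The Lipschitz bound of the Schur complement is proportional to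
`κ²`, which the tolerance does not compensate when `ε` is large. It is therefore combined with the
absolute bound `3κℓ`: the geometric mean of the two is of the order `√(M ε)`. -/
theorem norm_schurHess_sub_le_of_epsTilde (hdy : 1 ≤ dy) {e : ℝ} (he : 0 < e)
    {x : Vec dx} {y : Vec dy} (hy : ‖y - yStar f x‖ ≤ epsTilde ℓ ρ (cubicM (ℓ / μ) ρ) e) :
    ‖schurHess f x y - schurHess f x (yStar f x)‖ ≤ √(cubicM (ℓ / μ) ρ * e) / 12 := by
  have hℓ := hf.ell_pos
  have hρ := hf.rho_pos
  set κ := ℓ / μ with hκdef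
  have hκ : 1 ≤ κ := (one_le_div hf.mu_pos).2 (hf.mu_le_ell hdy)
  have h1 : ‖hess f x y - hess f x (yStar f x)‖ ≤ ρ * (1 / 192 * e / ℓ) := by
    refine (hf.norm_hess_sub_le x x y _).trans ?_
    rw [sub_self, norm_zero, zero_pow two_ne_zero, zero_add, Real.sqrt_sq (norm_nonneg _)]
    gcongr
    exact hy.trans (min_le_left _ _)
  have h2 : ‖schurHess f x y - schurHess f x (yStar f x)‖
      ≤ 2 * κ ^ 2 * (ρ * (1 / 192 * e / ℓ)) := by
    refine (hf.norm_schurHess_sub_le h1).trans ?_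
    gcongr
    rw [← hκdef]; nlinarith
  have h3 : ‖schurHess f x y - schurHess f x (yStar f x)‖ ≤ 3 * κ * ℓ := by
    refine (hf.norm_schurHess_sub_le_const x x y _).trans ?_
    gcongr
    rw [← hκdef]; linarith
  have h4 : 0 < κ ^ 3 * ρ * e := by positivity
  rw [le_div_iff₀ (by norm_num)]
  apply Real.le_sqrt_of_sq_le
  have h5 := mul_le_mul h2 h3 (norm_nonneg _) (by positivity)
  have h6 : 2 * κ ^ 2 * (ρ * (1 / 192 * e / ℓ)) * (3 * κ * ℓ) = 1 / 32 * (κ ^ 3 * ρ * e) := by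
    field_simp; ring
  have h7 : (9 : ℝ) / 8 ≤ √2 := Real.le_sqrt_of_sq_le (by norm_num)
  have h8 : cubicM κ ρ * e = 4 * √2 * (κ ^ 3 * ρ * e) := by rw [cubicM]; ring
  rw [h8, mul_pow]
  rw [h6] at h5
  nlinarith

end Assumptions

end Oracle

/-! ### The rounds of the algorithm -/

section Loop

variable {dx dy : ℕ} {f : Vec dx → Vec dy → ℝ} {ℓ ρ μ : ℝ}

namespace Assumptions

variable (hf : Assumptions f ℓ ρ μ)
include hf

/-- Accelerated gradient descent on `-f(x, ·)` tracks `y*(x)`. -/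
theorem norm_agd_sub_yStar_le (hdy : 1 ≤ dy) (x : Vec dx) {e r : ℝ} (he : 0 < e) {y₀ : Vec dy}
    (hr : ‖y₀ - yStar f x‖ ≤ r) {K : ℕ}
    (hK : 2 * √(ℓ / μ) * Real.log (√(ℓ / μ + 1) / e * r) ≤ K) :
    ‖(agd (fun y => -f x y) y₀ K (1 / ℓ) ((√(ℓ / μ) - 1) / (√(ℓ / μ) + 1))).y - yStar f x‖ ≤ e := by
  have hμ := hf.mu_pos
  have hgrad : ∀ z, HasGradientAt (fun y => -f x y) (-gradY f x z) z := by
    intro z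
    have h := (hf.hasGradientAt_right x z).hasFDerivAt.neg
    rw [← map_neg, ← hf.gradY_eq] at h
    exact h
  have hg : gradient (fun y => -f x y) = fun z => -gradY f x z :=
    funext fun z => (hgrad z).gradient
  refine norm_agd_sub_le_of_steps hμ ((one_le_div hμ).2 (hf.mu_le_ell hdy)) (by field_simp) he
    (fun z => by rw [hg]; exact hgrad z) (fun z w => ?_) (fun z w => ?_) ?_ hr hK
  · have := hf.norm_gradY_sub_le x x z w
    rw [sub_self, norm_zero, zero_pow two_ne_zero, zero_add, Real.sqrt_sq (norm_nonneg _)] at this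
    rw [hg, ← neg_sub', norm_neg]
    exact this
  · have := hf.strongly_concave x z w
    rw [hg, inner_neg_left]
    linarith
  · simp only [hg]
    rw [hf.gradY_yStar, neg_zero]

/-- Induction along the rounds. The hypothesis on `n` says that the primal gap is used up by `n`
long steps, hence the run ends with a short step. The gradient calls of a long step of length `r`
are charged, by `hA`, to the decrease `M r³/16` of `P`. -/
theorem mcnLoop_spec (hdy : 1 ≤ dy) {κ M q e et A : ℝ} (hκ : κ = ℓ / μ) (hM : M = cubicM κ ρ)
    (hq : 0 < q) (he : e = M * q ^ 2) (het : et = epsTilde ℓ ρ M e) (hA0 : 0 ≤ A)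
    (hA : ∀ r, q / 2 < r → 1 + (laterSteps κ et r : ℝ) ≤ A * (M / 16 * r ^ 3))
    {solver : Vec dx → (Vec dx →L[ℝ] Vec dx) → Vec dx} (hsolver : IsExactCubicSolver M solver)
    (n : ℕ) (x : Vec dx) (y : Vec dy) (hy : ‖y - yStar f x‖ ≤ et)
    (hn : (primal f x - primalInf f) * 192 ≤ n * (M * q ^ 3)) :
    IsSecondOrderStationary (primal f) (M * q ^ 2) (M * q) (mcnLoop f solver (1 / ℓ)
        ((√κ - 1) / (√κ + 1)) (q / 2) (laterSteps κ et) n x y).point ∧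
      ((mcnLoop f solver (1 / ℓ) ((√κ - 1) / (√κ + 1)) (q / 2) (laterSteps κ et) n x y).gradCalls
        : ℝ) ≤ A * (primal f x - primalInf f) + 1 ∧
      (mcnLoop f solver (1 / ℓ) ((√κ - 1) / (√κ + 1)) (q / 2) (laterSteps κ et) n x y).hessCalls
        ≤ n + 1 ∧
      (mcnLoop f solver (1 / ℓ) ((√κ - 1) / (√κ + 1)) (q / 2) (laterSteps κ et) n x y).invCalls
        ≤ n + 1 ∧
      (mcnLoop f solver (1 / ℓ) ((√κ - 1) / (√κ + 1)) (q / 2) (laterSteps κ et) n x y).cubicCalls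
        ≤ n + 1 := by
  have hℓ := hf.ell_pos
  have hρ := hf.rho_pos
  have hμ := hf.mu_pos
  have hκ0 : 0 < κ := by rw [hκ]; positivity
  have hM0 : 0 < M := by rw [hM, cubicM]; positivity
  have he0 : 0 < e := by rw [he]; positivity
  have het0 : 0 < et := by
    rw [het, epsTilde]; exact lt_min (by positivity) (by positivity)
  have hsqrt : √(M * e) = M * q := by
    rw [he, show M * (M * q ^ 2) = (M * q) ^ 2 by ring, Real.sqrt_sq (by positivity)]
  have hG : ∀ z, HasGradientAt (primal f) (gradient (primal f) z) z := fun z => by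
    rw [hf.gradient_primal]; exact hf.hasGradientAt_primal z
  have hQ := hf.hasFDerivAt_gradient_primal
  have hlip : ∀ z w, ‖schurHess f z (yStar f z) - schurHess f w (yStar f w)‖
      ≤ M / 2 * ‖z - w‖ := fun z w => by
    rw [hM, hκ]; exact hf.norm_hessian_primal_sub_le hdy z w
  -- The two possible outcomes of a round entered with an accurate `y`.
  have hround : ∀ (x : Vec dx) (y : Vec dy), ‖y - yStar f x‖ ≤ et →
      (q / 2 < ‖solver (gradX f x y) (schurHess f x y)‖ →
        primal f (x + solver (gradX f x y) (schurHess f x y))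
          ≤ primal f x - M / 16 * ‖solver (gradX f x y) (schurHess f x y)‖ ^ 3) ∧
      (‖solver (gradX f x y) (schurHess f x y)‖ ≤ q / 2 →
        IsSecondOrderStationary (primal f) (M * q ^ 2) (M * q)
          (x + solver (gradX f x y) (schurHess f x y))) := by
    intro x y hy
    have hH := hf.isSelfAdjoint_schurHess x y
    have hs := hsolver (gradX f x y) (schurHess f x y) hH
    have h1 : ‖gradX f x y - gradient (primal f) x‖ ≤ M * q ^ 2 / 192 := by
      rw [hf.gradient_primal, ← he]
      exact hf.norm_gradX_sub_le_of_epsTilde (by rw [← het]; exact hy)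
    have h2 : ‖schurHess f x y - schurHess f x (yStar f x)‖ ≤ M * q / 12 := by
      rw [← hsqrt, hM, hκ]
      exact hf.norm_schurHess_sub_le_of_epsTilde hdy he0 (by rw [← hκ, ← hM, ← het]; exact hy)
    refine ⟨fun hlong => cubic_step_descent (Q := fun z => schurHess f z (yStar f z))
      hM0 hq hG hQ hlip hH h1 h2 hs hlong, fun hshort => ⟨?_, ?_, ?_, ?_⟩⟩
    · exact Eventually.of_forall fun z => (hG z).differentiableAt
    · exact (hQ _).differentiableAt
    · exact cubic_step_gradient (Q := fun z => schurHess f z (yStar f z))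
        hM0 hq hQ hlip hH h1 h2 hs hshort
    · intro v
      rw [(hQ _).fderiv]
      exact cubic_step_hessian (Q := fun z => schurHess f z (yStar f z))
        hM0 hq hlip hH h2 hs hshort v
  induction n generalizing x y with
  | zero =>
    have hgap := hf.primalInf_le x
    obtain ⟨hlong, hshort⟩ := hround x y hy
    simp only [mcnLoop]
    -- The last round does not test its step: a long one would take `P` below its infimum.
    refine ⟨hshort ?_, ?_, by simp, by simp, by simp⟩
    · by_contra! hcon
      have h1 := hlong hcon
      have h2 := hf.primalInf_le (x + solver (gradX f x y) (schurHess f x y))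
      have h3 : 0 < ‖solver (gradX f x y) (schurHess f x y)‖ := by linarith
      have h4 : 0 < M / 16 * ‖solver (gradX f x y) (schurHess f x y)‖ ^ 3 := by positivity
      rw [Nat.cast_zero, zero_mul] at hn
      linarith
    · have : 0 ≤ A * (primal f x - primalInf f) := mul_nonneg hA0 (by linarith)
      simpa using this
  | succ n ih =>
    have hgap := hf.primalInf_le x
    obtain ⟨hlong, hshort⟩ := hround x y hy
    simp only [mcnLoop]
    set s := solver (gradX f x y) (schurHess f x y) with hs
    by_cases hthr : ‖s‖ ≤ q / 2
    · rw [if_pos hthr]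
      refine ⟨hshort hthr, ?_, by simp, by simp, by simp⟩
      have : 0 ≤ A * (primal f x - primalInf f) := mul_nonneg hA0 (by linarith)
      simpa using this
    · rw [if_neg hthr]
      push Not at hthr
      have hdesc := hlong hthr
      have hdist : ‖y - yStar f (x + s)‖ ≤ et + κ * ‖s‖ := by
        refine (norm_sub_le_norm_sub_add_norm_sub y (yStar f x) _).trans (add_le_add hy ?_)
        refine (hf.norm_yStar_sub_le _ _).trans_eq ?_
        rw [hκ, norm_sub_rev, add_sub_cancel_left]
      have hy' := hf.norm_agd_sub_yStar_le hdy (x + s) het0 hdist (K := laterSteps κ et ‖s‖)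
        (by rw [← hκ]; exact Nat.le_ceil _)
      rw [← hκ] at hy'
      have hcube : M * q ^ 3 ≤ 8 * (M * ‖s‖ ^ 3) := by
        have : q ^ 3 ≤ (2 * ‖s‖) ^ 3 := by gcongr; linarith
        calc M * q ^ 3 ≤ M * (2 * ‖s‖) ^ 3 := by gcongr
          _ = 8 * (M * ‖s‖ ^ 3) := by ring
      have hn' : (primal f (x + s) - primalInf f) * 192 ≤ n * (M * q ^ 3) := by
        push_cast at hn
        have : 0 < M * q ^ 3 := by positivity
        linarith
      obtain ⟨i1, i2, i3, i4, i5⟩ := ih (x + s) _ hy' hn'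
      refine ⟨i1, ?_, ?_, ?_, ?_⟩
      · rw [agd_calls]
        push_cast
        have h1 := hA ‖s‖ hthr
        have h2 := mul_le_mul_of_nonneg_left
          (show M / 16 * ‖s‖ ^ 3 + (primal f (x + s) - primalInf f) ≤ primal f x - primalInf f by
            linarith) hA0
        linarith
      · dsimp only; omega
      · dsimp only; omega
      · dsimp only; omega

end Assumptions

end Loop

/-! ### Numbers of accelerated steps -/

section Complexity

theorem sqrt_add_one_le {κ X : ℝ} (hX2 : 2 ≤ X) (hX : 2 + κ ≤ X) : √(κ + 1) ≤ X := by
  rw [Real.sqrt_le_left (by linarith)]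
  nlinarith

theorem half_le_log {X : ℝ} (hX2 : 2 ≤ X) : 1 / 2 ≤ Real.log X :=
  (by linarith [Real.log_two_gt_d9] : (1 : ℝ) / 2 ≤ Real.log 2).trans
    (Real.log_le_log (by norm_num) hX2)

/-- The gradient calls of a round with a long step are paid for by the cube of its length: the
logarithm of `1 + r/q` is absorbed by `(r/q)³`. -/
theorem one_add_laterSteps_le {κ et q X r : ℝ} (hκ : 1 ≤ κ) (het : 0 < et) (hq : 0 < q)
    (hX : 2 + κ ≤ X) (hqe : q / et ≤ 192 * X) (hr : q / 2 < r) :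
    1 + (laterSteps κ et r : ℝ) ≤ 224 * (√κ * Real.log X) * (r / q) ^ 3 := by
  have hX2 : 2 ≤ X := by linarith
  have hr0 : 0 < r := by linarith
  have hl := half_le_log hX2
  have hsκ : 1 ≤ √κ := Real.one_le_sqrt.2 hκ
  set u := r / q with hu
  have hu2 : 1 / 2 < u := by rw [hu, lt_div_iff₀ hq]; linarith
  -- Numerical constants are absorbed into powers of `X ≥ 2`.
  have harg : √(κ + 1) / et * (et + κ * r) ≤ X ^ 11 * Real.exp u := by
    have e1 : √(κ + 1) / et * (et + κ * r) = √(κ + 1) * (1 + κ * (q / et) * u) := by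
      rw [hu]; field_simp
    have h1 : κ * (q / et) ≤ X * (192 * X) := by gcongr; linarith
    have h2 : 1 + κ * (q / et) * u ≤ (193 * X ^ 2) * Real.exp u := by
      have h3 := Real.add_one_le_exp u
      have h4 : 1 ≤ X ^ 2 := one_le_pow₀ (by linarith)
      have h5 : κ * (q / et) * u ≤ X * (192 * X) * u := by gcongr
      calc 1 + κ * (q / et) * u ≤ (193 * X ^ 2) * (u + 1) := by nlinarith
        _ ≤ (193 * X ^ 2) * Real.exp u := by gcongr
    have h6 : (193 : ℝ) ≤ X ^ 8 := by
      calc (193 : ℝ) ≤ 2 ^ 8 := by norm_num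
        _ ≤ X ^ 8 := by gcongr
    rw [e1]
    calc √(κ + 1) * (1 + κ * (q / et) * u) ≤ X * ((193 * X ^ 2) * Real.exp u) := by
          gcongr; exact sqrt_add_one_le hX2 hX
      _ = 193 * (X ^ 3 * Real.exp u) := by ring
      _ ≤ X ^ 8 * (X ^ 3 * Real.exp u) := by gcongr
      _ = X ^ 11 * Real.exp u := by ring
  have hpos : 0 < √(κ + 1) / et * (et + κ * r) := by positivity
  have hlog : Real.log (√(κ + 1) / et * (et + κ * r)) ≤ 11 * Real.log X + u := by
    refine (Real.log_le_log hpos harg).trans_eq ?_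
    rw [Real.log_mul (by positivity) (Real.exp_pos _).ne', Real.log_exp, Real.log_pow]
    norm_num
  have hceil : (laterSteps κ et r : ℝ) ≤ 2 * √κ * (11 * Real.log X + u) + 1 := by
    have h1 : laterSteps κ et r ≤ ⌈2 * √κ * (11 * Real.log X + u)⌉₊ := by
      apply Nat.ceil_mono; gcongr
    have h2 := (Nat.ceil_lt_add_one
      (show 0 ≤ 2 * √κ * (11 * Real.log X + u) by positivity)).le
    exact (Nat.cast_le.2 h1).trans h2
  have hl' : 1 ≤ 2 * Real.log X := by linarith
  have hsl : 1 ≤ 2 * (√κ * Real.log X) := by nlinarith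
  have hu3 : 1 ≤ 8 * u ^ 3 := by
    have : (1 / 2 : ℝ) ^ 3 ≤ u ^ 3 := by gcongr
    linarith
  have hu4 : u ≤ 4 * u ^ 3 := by nlinarith [sq_nonneg (u - 1 / 2)]
  have hsu : √κ * u ≤ 2 * (√κ * Real.log X) * (4 * u ^ 3) := by
    calc √κ * u ≤ √κ * (2 * Real.log X) * (4 * u ^ 3) := by
          apply mul_le_mul _ hu4 (by positivity) (by positivity)
          nlinarith
      _ = _ := by ring
  have hs1 : 0 ≤ √κ * Real.log X := by positivity
  have h9 : √κ * Real.log X ≤ (√κ * Real.log X) * (8 * u ^ 3) := le_mul_of_one_le_right hs1 hu3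
  nlinarith

theorem firstSteps_le {κ et X r : ℝ} (hκ : 1 ≤ κ) (het : 0 < et) (hr0 : 0 ≤ r)
    (hX : 2 + κ ≤ X) (hre : r / et ≤ 1584 * X) :
    (firstSteps κ et r : ℝ) ≤ 26 * (√κ * Real.log X) + 1 := by
  have hX2 : 2 ≤ X := by linarith
  have hl := half_le_log hX2
  have hlog : Real.log (√(κ + 1) / et * r) ≤ 13 * Real.log X := by
    rcases hr0.eq_or_lt with rfl | hr
    -- `Real.log 0 = 0`: no step is made when the start is already optimal.
    · rw [mul_zero, Real.log_zero]; positivity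
    · have hpos : 0 < √(κ + 1) / et * r := by positivity
      have h1 : √(κ + 1) / et * r ≤ X ^ 13 := by
        have h6 : (1584 : ℝ) ≤ X ^ 11 := by
          calc (1584 : ℝ) ≤ 2 ^ 11 := by norm_num
            _ ≤ X ^ 11 := by gcongr
        calc √(κ + 1) / et * r = √(κ + 1) * (r / et) := by ring
          _ ≤ X * (1584 * X) := by gcongr; exact sqrt_add_one_le hX2 hX
          _ = 1584 * X ^ 2 := by ring
          _ ≤ X ^ 11 * X ^ 2 := by gcongr
          _ = X ^ 13 := by ring
      refine (Real.log_le_log hpos h1).trans_eq ?_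
      rw [Real.log_pow]; norm_num
  have h1 : firstSteps κ et r ≤ ⌈26 * (√κ * Real.log X)⌉₊ := by
    apply Nat.ceil_mono
    calc 2 * √κ * Real.log (√(κ + 1) / et * r) ≤ 2 * √κ * (13 * Real.log X) := by gcongr
      _ = 26 * (√κ * Real.log X) := by ring
  exact (Nat.cast_le.2 h1).trans
    (Nat.ceil_lt_add_one (show 0 ≤ 26 * (√κ * Real.log X) by positivity)).le

end Complexity

/-! ### Identities between the parameters -/

section Parameters

variable {ℓ κ ρ ε : ℝ}

theorem epsPrime_eq (ε : ℝ) : epsPrime ε = ε / (4 * √2) := by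
  have : (2 : ℝ) ^ (-(5 / 2) : ℝ) = 1 / (4 * √2) := by
    rw [Real.rpow_neg zero_le_two, show (5 / 2 : ℝ) = 2 + 1 / 2 by norm_num,
      Real.rpow_add two_pos, ← Real.sqrt_eq_rpow, one_div]
    norm_num
  rw [epsPrime, this]; ring

theorem epsPrime_pos (hε : 0 < ε) : 0 < epsPrime ε := by
  rw [epsPrime_eq]; positivity

theorem cubicM_pos (hκ : 0 < κ) (hρ : 0 < ρ) : 0 < cubicM κ ρ := by
  rw [cubicM]; positivity

theorem epsTilde_pos {M e : ℝ} (hℓ : 0 < ℓ) (hρ : 0 < ρ) (hM : 0 < M) (he : 0 < e) :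
    0 < epsTilde ℓ ρ M e :=
  lt_min (by positivity) (by positivity)

theorem mul_sqrt_div_self_sq {M e : ℝ} (hM : 0 < M) (he : 0 < e) : M * √(e / M) ^ 2 = e := by
  rw [Real.sq_sqrt (by positivity)]; field_simp

theorem rpow_three_halves {t : ℝ} (ht : 0 < t) : t ^ (3 / 2 : ℝ) = t * √t := by
  rw [show (3 / 2 : ℝ) = 1 + 1 / 2 by norm_num, Real.rpow_add ht, Real.rpow_one,
    ← Real.sqrt_eq_rpow]

/-- `√(M ε')` is the curvature tolerance `κ^{3/2} √(ρ ε)`. -/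
theorem cubicM_mul_sqrt (hκ : 0 < κ) (hρ : 0 < ρ) (hε : 0 < ε) :
    cubicM κ ρ * √(epsPrime ε / cubicM κ ρ) = κ ^ (3 / 2 : ℝ) * √(ρ * ε) := by
  have hM := cubicM_pos hκ hρ
  have he := epsPrime_pos hε
  rw [rpow_three_halves hκ, ← sq_eq_sq₀ (by positivity) (by positivity), mul_pow, mul_pow, mul_pow,
    Real.sq_sqrt (by positivity), Real.sq_sqrt hκ.le, Real.sq_sqrt (by positivity), epsPrime_eq]
  have : cubicM κ ρ ^ 2 * (ε / (4 * √2) / cubicM κ ρ) = cubicM κ ρ * ε / (4 * √2) := by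
    field_simp
  rw [this, cubicM]
  field_simp

/-- The reciprocal of the unit `M q³` in which the decrease of `P` is measured, `q = √(ε'/M)`. -/
theorem one_div_cubicM_mul_cube (hκ : 0 < κ) (hρ : 0 < ρ) (hε : 0 < ε) :
    1 / (cubicM κ ρ * √(epsPrime ε / cubicM κ ρ) ^ 3)
      = 32 * (κ ^ (3 / 2 : ℝ) * √ρ * ε ^ (-(3 / 2) : ℝ)) := by
  have hM := cubicM_pos hκ hρ
  have he := epsPrime_pos hε
  have h1 := mul_sqrt_div_self_sq hM he
  have h2 := cubicM_mul_sqrt hκ hρ hε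
  set q := √(epsPrime ε / cubicM κ ρ) with hq
  have hq0 : 0 < q := Real.sqrt_pos.2 (by positivity)
  have h3 : 1 / (cubicM κ ρ * q ^ 3) = cubicM κ ρ / ((cubicM κ ρ * q) * (cubicM κ ρ * q ^ 2)) := by
    field_simp
  rw [h3, h1, h2, epsPrime_eq, Real.rpow_neg hε.le, rpow_three_halves hκ, rpow_three_halves hε,
    Real.sqrt_mul hρ.le, cubicM]
  have e1 : √κ ^ 2 = κ := Real.sq_sqrt hκ.le
  have e2 : √ρ ^ 2 = ρ := Real.sq_sqrt hρ.le
  have e3 : √(2 : ℝ) ^ 2 = 2 := Real.sq_sqrt zero_le_two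
  field_simp
  rw [e1, e2, e3]
  ring

theorem maxRounds_eq {Δ M e : ℝ} (hM : 0 < M) (he : 0 < e) :
    maxRounds Δ M e = ⌈192 * Δ * (1 / (M * √(e / M) ^ 3))⌉₊ + 1 := by
  have h : √M * e ^ (-(3 / 2) : ℝ) = 1 / (M * √(e / M) ^ 3) := by
    have e1 : √M ^ 2 = M := Real.sq_sqrt hM.le
    have e2 : √e ^ 2 = e := Real.sq_sqrt he.le
    have h1 : 0 < √M := by positivity
    have h2 : 0 < √e := by positivity
    have h3 : M * (√e / √M) ^ 3 = e * √e / √M := by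
      calc M * (√e / √M) ^ 3 = M * (√e ^ 2 * √e) / (√M ^ 2 * √M) := by rw [div_pow]; ring
        _ = e * √e / √M := by rw [e1, e2]; field_simp
    rw [Real.rpow_neg he.le, rpow_three_halves he, Real.sqrt_div he.le, h3, one_div_div]
    rfl
  rw [maxRounds, mul_assoc, h]

theorem one_div_epsTilde_le {M e q : ℝ} (hℓ : 0 < ℓ) (hρ : 0 < ρ) (hM : 0 < M) (hq : 0 < q)
    (he : e = M * q ^ 2) :
    1 / epsTilde ℓ ρ M e ≤ 192 * ℓ / e + 48 * ρ / (M * q) := by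
  have he0 : 0 < e := by rw [he]; positivity
  have hsqrt : √(M * e) = M * q := by
    rw [he, show M * (M * q ^ 2) = (M * q) ^ 2 by ring, Real.sqrt_sq (by positivity)]
  rw [epsTilde, hsqrt]
  rcases min_choice (1 / 192 * e / ℓ) (1 / 48 * (M * q) / ρ) with h | h <;> rw [h]
  · have : 1 / (1 / 192 * e / ℓ) = 192 * ℓ / e := by field_simp
    rw [this]; exact le_add_of_nonneg_right (by positivity)
  · have : 1 / (1 / 48 * (M * q) / ρ) = 48 * ρ / (M * q) := by field_simp
    rw [this]; exact le_add_of_nonneg_left (by positivity)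

theorem sqrt_le_cubicM_mul_sqrt (hκ : 1 ≤ κ) (hρ : 0 < ρ) (hε : 0 < ε) :
    √(ρ * ε) ≤ cubicM κ ρ * √(epsPrime ε / cubicM κ ρ) := by
  rw [cubicM_mul_sqrt (by linarith) hρ hε]
  exact le_mul_of_one_le_left (by positivity) (Real.one_le_rpow hκ (by norm_num))

theorem sqrt_epsPrime_div_epsTilde_le (hℓ : 0 < ℓ) (hκ : 1 ≤ κ) (hρ : 0 < ρ) (hε : 0 < ε) :
    √(epsPrime ε / cubicM κ ρ) / epsTilde ℓ ρ (cubicM κ ρ) (epsPrime ε)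
      ≤ 192 * (ℓ / √(ρ * ε)) + 48 := by
  have hM := cubicM_pos (by linarith : 0 < κ) hρ
  have he := epsPrime_pos hε
  have h1 := (mul_sqrt_div_self_sq hM he).symm
  have h2 := sqrt_le_cubicM_mul_sqrt hκ hρ hε
  set M := cubicM κ ρ with hMdef
  set e := epsPrime ε with hedef
  set q := √(e / M) with hq
  have hq0 : 0 < q := Real.sqrt_pos.2 (by positivity)
  have h3 := mul_le_mul_of_nonneg_left (one_div_epsTilde_le hℓ hρ hM hq0 h1) hq0.le
  have h4 : q * (192 * ℓ / e) = 192 * (ℓ / (M * q)) := by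
    have : 192 * ℓ / e = 192 * ℓ / (M * q ^ 2) := by rw [← h1]
    rw [this]; field_simp
  have h5 : q * (48 * ρ / (M * q)) = 48 * (ρ / M) := by field_simp
  have h6 : ℓ / (M * q) ≤ ℓ / √(ρ * ε) := by gcongr
  have h7 : ρ / M ≤ 1 := by
    rw [div_le_one hM, hMdef, cubicM]
    have i1 : 1 ≤ κ ^ 3 := one_le_pow₀ hκ
    have i2 : 1 ≤ √(2 : ℝ) := Real.one_le_sqrt.2 one_le_two
    have i3 : 1 ≤ 4 * √2 * κ ^ 3 := by nlinarith
    exact le_mul_of_one_le_left hρ.le i3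
  rw [mul_one_div, mul_add, h4, h5] at h3
  linarith

theorem div_epsTilde_le {r : ℝ} (hr : 0 ≤ r) (hℓ : 0 < ℓ) (hκ : 1 ≤ κ) (hρ : 0 < ρ) (hε : 0 < ε) :
    r / epsTilde ℓ ρ (cubicM κ ρ) (epsPrime ε) ≤ 1536 * (ℓ * r / ε) + 48 * (r * √(ρ / ε)) := by
  have hM := cubicM_pos (by linarith : 0 < κ) hρ
  have he := epsPrime_pos hε
  have h1 := (mul_sqrt_div_self_sq hM he).symm
  have h2 := sqrt_le_cubicM_mul_sqrt hκ hρ hε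
  set M := cubicM κ ρ with hMdef
  set q := √(epsPrime ε / M) with hq
  have hq0 : 0 < q := Real.sqrt_pos.2 (by positivity)
  have h3 := mul_le_mul_of_nonneg_left (one_div_epsTilde_le hℓ hρ hM hq0 h1) hr
  have h4 : r * (192 * ℓ / epsPrime ε) = 768 * √2 * (ℓ * r / ε) := by
    rw [epsPrime_eq]; field_simp; ring
  have h5 : √(2 : ℝ) ≤ 2 := (Real.sqrt_le_left zero_le_two).2 (by norm_num)
  have h6 : 768 * √2 * (ℓ * r / ε) ≤ 1536 * (ℓ * r / ε) := by
    gcongr; linarith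
  have h7 : ρ / (M * q) ≤ √(ρ / ε) := by
    have h8 : ρ / √(ρ * ε) = √(ρ / ε) := by
      have i2 : 0 < √ε := by positivity
      rw [Real.sqrt_mul hρ.le, Real.sqrt_div hρ.le, ← div_div, Real.div_sqrt]
    rw [← h8]; gcongr
  have h8 : r * (48 * ρ / (M * q)) ≤ 48 * (r * √(ρ / ε)) := by
    calc r * (48 * ρ / (M * q)) = 48 * (r * (ρ / (M * q))) := by ring
      _ ≤ _ := by gcongr
  rw [mul_one_div, mul_add, h4] at h3
  linarith

end Parameters

end MCN

theorem mainTheorem3 :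
    ∃ C : ℝ, 0 < C ∧
      ∀ (dx dy : ℕ), 1 ≤ dy →
      ∀ (f : MCN.Vec dx → MCN.Vec dy → ℝ) (ℓ ρ μ : ℝ), MCN.Assumptions f ℓ ρ μ →
      ∀ (κ M : ℝ), κ = ℓ / μ → M = MCN.cubicM κ ρ →
      ∀ (solver : MCN.Vec dx → (MCN.Vec dx →L[ℝ] MCN.Vec dx) → MCN.Vec dx),
        MCN.IsExactCubicSolver M solver →
      ∀ (x₀ : MCN.Vec dx) (ε ε' εt Δ r₀ : ℝ), 0 < ε →
        ε' = MCN.epsPrime ε →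
        εt = MCN.epsTilde ℓ ρ M ε' →
        Δ = MCN.primal f x₀ - MCN.primalInf f →
        r₀ = ‖MCN.yStar f x₀‖ →
      ∀ (out : MCN.Outcome dx),
        out = MCN.mcn f solver ℓ κ M ε' (MCN.maxRounds Δ M ε')
          (MCN.firstSteps κ εt r₀) (MCN.laterSteps κ εt) x₀ →
        MCN.IsSecondOrderStationary (MCN.primal f) ε (κ ^ (3 / 2 : ℝ) * √(ρ * ε)) out.point ∧
        (out.gradCalls : ℝ) ≤
          C * (Δ * κ ^ 2 * √ρ * ε ^ (-(3 / 2) : ℝ) + √κ) *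
            Real.log (2 + κ + ℓ * r₀ / ε + r₀ * √(ρ / ε) + ℓ / √(ρ * ε)) ∧
        (out.hessCalls : ℝ) ≤ C * (Δ * κ ^ (3 / 2 : ℝ) * √ρ * ε ^ (-(3 / 2) : ℝ) + 1) ∧
        (out.invCalls : ℝ) ≤ C * (Δ * κ ^ (3 / 2 : ℝ) * √ρ * ε ^ (-(3 / 2) : ℝ) + 1) ∧
        (out.cubicCalls : ℝ) ≤ C * (Δ * κ ^ (3 / 2 : ℝ) * √ρ * ε ^ (-(3 / 2) : ℝ) + 1) := by
  -- `114688 = 32 * 3584`: the factor of `1 / (M q³)` times the constant of the charge `A` below.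
  refine ⟨114688, by norm_num, ?_⟩
  rintro dx dy hdy f ℓ ρ μ hf κ M hκdef rfl solver hsolver x₀ ε ε' εt Δ r₀ hε rfl hεt hΔ hr₀
    out rfl
  have hℓ := hf.ell_pos
  have hρ := hf.rho_pos
  have hκ : 1 ≤ κ := by rw [hκdef]; exact (one_le_div hf.mu_pos).2 (hf.mu_le_ell hdy)
  have hκ0 : 0 < κ := by linarith
  have hM0 := MCN.cubicM_pos hκ0 hρ
  have he0 := MCN.epsPrime_pos hε
  have hεt0 : 0 < εt := hεt ▸ MCN.epsTilde_pos hℓ hρ hM0 he0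
  have hΔ0 : 0 ≤ Δ := by rw [hΔ]; exact sub_nonneg.2 (hf.primalInf_le x₀)
  have hr0 : 0 ≤ r₀ := by rw [hr₀]; exact norm_nonneg _
  have hMq2 := (MCN.mul_sqrt_div_self_sq hM0 he0).symm
  have hMq := MCN.cubicM_mul_sqrt hκ0 hρ hε
  have hMq3 := MCN.one_div_cubicM_mul_cube hκ0 hρ hε
  have hqe := MCN.sqrt_epsPrime_div_epsTilde_le hℓ hκ hρ hε
  have hre := MCN.div_epsTilde_le hr0 hℓ hκ hρ hε
  have hrounds := MCN.maxRounds_eq (Δ := Δ) hM0 he0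
  rw [← hεt] at hqe hre
  have hq : 0 < √(MCN.epsPrime ε / MCN.cubicM κ ρ) := Real.sqrt_pos.2 (by positivity)
  set M := MCN.cubicM κ ρ with hMdef
  set q := √(MCN.epsPrime ε / M) with hqdef
  set X := 2 + κ + ℓ * r₀ / ε + r₀ * √(ρ / ε) + ℓ / √(ρ * ε) with hX
  have t1 : 0 ≤ ℓ * r₀ / ε := by positivity
  have t2 : 0 ≤ r₀ * √(ρ / ε) := by positivity
  have t3 : 0 ≤ ℓ / √(ρ * ε) := by positivity
  have hXκ : 2 + κ ≤ X := by linarith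
  have hl := MCN.half_le_log (show 2 ≤ X by linarith)
  have hsκ : 1 ≤ √κ := Real.one_le_sqrt.2 hκ
  -- The price of one unit of decrease of `P`: a long step of length `r` decreases `P` by at least
  -- `M r³ / 16` and costs at most `224 √κ log X (r/q)³` gradient calls, and `3584 = 16 * 224`.
  set A := 3584 * (√κ * Real.log X) * (1 / (M * q ^ 3)) with hAdef
  have hA0 : 0 ≤ A := by positivity
  have hA : ∀ r, q / 2 < r → 1 + (MCN.laterSteps κ εt r : ℝ) ≤ A * (M / 16 * r ^ 3) := by
    intro r hr
    refine (MCN.one_add_laterSteps_le hκ hεt0 hq hXκ (by linarith) hr).trans_eq ?_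
    rw [hAdef, div_pow]; field_simp; ring
  have hy₀ := hf.norm_agd_sub_yStar_le hdy x₀ hεt0 (y₀ := 0) (r := r₀)
    (by rw [zero_sub, norm_neg, hr₀]) (K := MCN.firstSteps κ εt r₀)
    (by rw [← hκdef]; exact Nat.le_ceil _)
  rw [← hκdef] at hy₀
  set N := ⌈192 * Δ * (1 / (M * q ^ 3))⌉₊ with hN
  have hn : (MCN.primal f x₀ - MCN.primalInf f) * 192 ≤ N * (M * q ^ 3) := by
    rw [← hΔ]
    have h1 : 192 * Δ * (1 / (M * q ^ 3)) ≤ N := Nat.le_ceil _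
    calc Δ * 192 = 192 * Δ * (1 / (M * q ^ 3)) * (M * q ^ 3) := by field_simp
      _ ≤ N * (M * q ^ 3) := by gcongr
  obtain ⟨⟨hdiff, hdiff2, hgrad, hhess⟩, hgc, hhc, hic, hcc⟩ :=
    hf.mcnLoop_spec hdy hκdef hMdef hq hMq2 hεt hA0 hA hsolver N x₀ _ hy₀ hn
  have hcount : ∀ c : ℕ, c ≤ N + 1 →
      (c : ℝ) ≤ 114688 * (Δ * κ ^ (3 / 2 : ℝ) * √ρ * ε ^ (-(3 / 2) : ℝ) + 1) := by
    intro c hc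
    have h1 : (c : ℝ) ≤ (N : ℝ) + 1 := by exact_mod_cast hc
    have h3 : (N : ℝ) < 192 * Δ * (1 / (M * q ^ 3)) + 1 := Nat.ceil_lt_add_one (by positivity)
    rw [hMq3] at h3
    have h4 : 0 ≤ Δ * κ ^ (3 / 2 : ℝ) * √ρ * ε ^ (-(3 / 2) : ℝ) := by positivity
    linarith
  rw [← hΔ] at hgc
  rw [MCN.mcn, hrounds, Nat.add_sub_cancel, ← hqdef, one_div_mul_eq_div]
  refine ⟨⟨hdiff, hdiff2, hgrad.trans ?_, ?_⟩, ?_, hcount _ hhc, hcount _ hic, hcount _ hcc⟩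
  · rw [← hMq2, MCN.epsPrime_eq]
    exact div_le_self hε.le (by linarith [Real.one_le_sqrt.2 one_le_two])
  · rw [← hMq]
    exact hhess
  · dsimp only
    rw [MCN.agd_calls]
    push_cast
    have h1 := MCN.firstSteps_le hκ hεt0 hr0 hXκ (by linarith)
    have h2 : κ ^ 2 = κ ^ (3 / 2 : ℝ) * √κ := by
      rw [MCN.rpow_three_halves hκ0, mul_assoc, Real.mul_self_sqrt hκ0.le, sq]
    have h3 : A * Δ = 114688 * (Δ * κ ^ 2 * √ρ * ε ^ (-(3 / 2) : ℝ)) * Real.log X := by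
      rw [hAdef, hMq3, h2]; ring
    have h4 : 1 ≤ 2 * (√κ * Real.log X) := by nlinarith
    rw [mul_add, add_mul, ← h3]
    linarith
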